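/- All graphs are finite and simple. For a connected graph $G$, a set $W\subseteq V(G)$ and a vertex $v$, let $r_m(v|W)$ be the multiset of distances $d(v,w)$, $w\in W$. The set $W$ is m-resolving if $r_m(u|W)\neq r_m(v|W)$ for all distinct vertices $u,v$. The multiset dimension $md(G)$ is the least cardinality of an m-resolving set, and $md(G)=\infty$ if there is none. A lobster is a tree $G$ containing a $2$-center-path, i.e. a path $P$ such that every vertex of $G$ is at distance at most $2$ from $P$; a minimum $2$-center-path is one of minimum length (a single vertex is a path of length $0$). $P_n$ is the path and $S_n$ the star on $n$ vertices. Let $G-E(P)$ be $G$ with the edges of $P$ removed. Each component $H$ of $G-E(P)$ is rooted at its unique vertex on $P$. The separation $[H]$ of a rooted tree $H$ with root $v$ is the graph obtained by subdividing every edge at $v$ and then deleting $v$. **Theorem 3.1.** Let $G$ be a lobster and $P$ a minimum $2$-center-path of $G$ with ends $a$ and $b$. Consider the statements (1) $md(G)$ is finite; (2) every component of $G-E(P)$ with infinite multiset dimension is an $S_4$ whose root is one of its leaves; (3) for each component $H$ of $G-E(P)$, the separation $[H]$ has at most $4$ components, each of them a $P_2$, a $P_3$ or an $S_4$, with at most two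 $P_2$s and at most two $S_4$s. Then (1) implies (2), and (2) is equivalent to (3). Moreover (1), (2) and (3) are all equivalent, unless either $G$ is itself an $S_4$ and $P$ consists of one of its leaves, or $P$ has length $2$ and both $a$ and $b$ have degree $5$ in $G$. -/

import Mathlib

namespace MultisetDim

universe u

variable {V : Type u}

/-- The representation multiset `r_m(v | W)`: the multiset of the distances from `v` to the
vertices of `W`. -/
noncomputable def repMultiset (G : SimpleGraph V) (W : Finset V) (v : V) : Multiset ℕ :=
  W.val.map fun w => G.dist v w

/-- `W` is an m-resolving set of `G`: distinct vertices have distinct representation multisets. -/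
def IsMResolving (G : SimpleGraph V) (W : Finset V) : Prop :=
  ∀ u v : V, u ≠ v → repMultiset G W u ≠ repMultiset G W v

/-- The multiset dimension `md(G)`: the least cardinality of an m-resolving set, and `⊤` if there
is no m-resolving set. -/
noncomputable def multisetDim (G : SimpleGraph V) : ℕ∞ :=
  ⨅ (W : Finset V) (_ : IsMResolving G W), (W.card : ℕ∞)

/-- A path `p` of the connected graph `G` is a `k`-center-path if every vertex of `G` is at
distance at most `k` from some vertex of `p`. -/
def IsCenterPath (G : SimpleGraph V) (k : ℕ) {a b : V} (p : G.Walk a b) : Prop :=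
  p.IsPath ∧ ∀ u : V, ∃ w ∈ p.support, G.dist u w ≤ k

/-- A `k`-center-path of minimum length. -/
def IsMinCenterPath (G : SimpleGraph V) (k : ℕ) {a b : V} (p : G.Walk a b) : Prop :=
  IsCenterPath G k p ∧
    ∀ (c d : V) (q : G.Walk c d), IsCenterPath G k q → p.length ≤ q.length

/-- A lobster is a tree containing a `2`-center-path. -/
def IsLobster (G : SimpleGraph V) : Prop :=
  G.IsTree ∧ ∃ (a b : V) (p : G.Walk a b), IsCenterPath G 2 p

/-- `G` is a path `P_n` on `n` vertices. -/
def IsPathOn (n : ℕ) (G : SimpleGraph V) : Prop :=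
  Nonempty (G ≃g SimpleGraph.pathGraph n)

/-- `G` is an `S_4`, the star on four vertices. -/
def IsS4 (G : SimpleGraph V) : Prop :=
  Nonempty (G ≃g completeBipartiteGraph (Fin 1) (Fin 3))

/-- `r` is a leaf of `G`. -/
def IsLeaf (G : SimpleGraph V) (r : V) : Prop :=
  (G.neighborSet r).ncard = 1

/-- The separation `[T]` of `T` with root `r`: every edge `r w` at the root is subdivided, and then
`r` is deleted. `Sum.inl w` is the vertex `w ≠ r` of `T`, and `Sum.inr w` is the new vertex in the
middle of the edge `r w`; after the deletion of `r` its only neighbor is `w`. -/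
def separation (T : SimpleGraph V) (r : V) :
    SimpleGraph ({w : V // w ≠ r} ⊕ {w : V // T.Adj r w}) where
  Adj x y := match x, y with
    | Sum.inl x, Sum.inl y => T.Adj x y
    | Sum.inl x, Sum.inr y => (x : V) = y
    | Sum.inr x, Sum.inl y => (x : V) = y
    | Sum.inr _, Sum.inr _ => False
  symm := ⟨by
    rintro (x | x) (y | y) h
    · exact T.adj_symm h
    · exact Eq.symm h
    · exact Eq.symm h
    · exact h⟩
  loopless := ⟨by
    rintro (x | x) h
    · exact T.irrefl h
    · exact h⟩

/-- The graph `G - E(P)`. -/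
def deletePath (G : SimpleGraph V) {a b : V} (p : G.Walk a b) : SimpleGraph V :=
  G.deleteEdges {e | e ∈ p.edges}

/-- `H`, rooted at `r`, is an `S_4` whose root is one of its leaves. -/
def IsLeafRootedS4 (H : SimpleGraph V) (r : V) : Prop :=
  IsS4 H ∧ IsLeaf H r

/-- The only components of `G - E(P)` with infinite multiset dimension are `S_4`s (each rooted at
a leaf, the root of a component being its vertex on `P`). -/
def OnlyS4Infinite (G : SimpleGraph V) {a b : V} (p : G.Walk a b) : Prop :=
  ∀ (C : (deletePath G p).ConnectedComponent) (r : C), (r : V) ∈ p.support →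
    multisetDim C.toSimpleGraph = ⊤ → IsLeafRootedS4 C.toSimpleGraph r

/-- The separation of the rooted graph `(H, r)` has at most four components, each of them a `P_2`,
a `P_3` or an `S_4`, among them at most two `P_2`s and at most two `S_4`s. -/
def SmallSeparation (H : SimpleGraph V) (r : V) : Prop :=
  Nat.card (separation H r).ConnectedComponent ≤ 4 ∧
  (∀ D : (separation H r).ConnectedComponent,
    IsPathOn 2 D.toSimpleGraph ∨ IsPathOn 3 D.toSimpleGraph ∨ IsS4 D.toSimpleGraph) ∧
  {D : (separation H r).ConnectedComponent | IsPathOn 2 D.toSimpleGraph}.ncard ≤ 2 ∧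
  {D : (separation H r).ConnectedComponent | IsS4 D.toSimpleGraph}.ncard ≤ 2

/-- Every component of `G - E(P)`, rooted at its vertex on `P`, satisfies `SmallSeparation`. -/
def AllSeparationsSmall (G : SimpleGraph V) {a b : V} (p : G.Walk a b) : Prop :=
  ∀ (C : (deletePath G p).ConnectedComponent) (r : C), (r : V) ∈ p.support →
    SmallSeparation C.toSimpleGraph r

/-- The two small exceptional situations: `P` is a single vertex that is a leaf of `G = S_4`, or
`P` has length `2` and both of its ends have degree `5` in `G`. -/
def IsExceptional (G : SimpleGraph V) {a b : V} (p : G.Walk a b) : Prop :=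
  IsLeafRootedS4 G a ∨
    (p.length = 2 ∧ (G.neighborSet a).ncard = 5 ∧ (G.neighborSet b).ncard = 5)

end MultisetDim

/-!
Let `P 0, …, P ℓ` be the vertices of the path. Every vertex `w` of the lobster has an index `idx
w`, that of the nearest path vertex, and a depth `dep w ≤ 2`, its distance to the path
(`PathFrame`). In these coordinates distances are explicit: `dist u w = dep u + |idx u - idx w| +
dep w` as soon as the indices differ. A component of `G - E(P)` consists of a path vertex with its
branches, a branch being a child `v` together with its leaves at depth `2`. The separation of the
component is a disjoint union of stars, one on `k + 2` vertices for each branch with `k` leaves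
(`PathFrame.smallSeparation_iff`), so all the statements concern the numbers of leaves of the
branches (`SmallBranches`).

*Necessity* (`PathFrame.smallBranches_of_isMResolving`). Fix a set `W` of landmarks and label the
child `v` by the pair `(s, t)`, where `s` says whether `v ∈ W` and `t` is the number of leaves of
`v` in `W`. Children of the same path vertex with equal labels see the same distances, and so do
leaves of the same child that both lie in `W` or both outside. Hence in an m-resolving set `t ≤
1`, there are at most four labels, with `t = 0` for a branch without leaves and `t = 1` for a
branch with two leaves, and no child has three leaves. The argument applies to `G` as well as to a
single component.

*Sufficiency.* Conversely, suppose that labels are chosen subject to these constraints, with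
landmarks at depth `2` below both ends of the path. Vertices of the same index and depth are told
apart by the numbers of landmarks at distances `0`, `1`, `2`. The largest distance to a landmark
is `dep u + 2 + max (idx u) (ℓ - idx u)`, and if it is the same for two vertices of different
index on the same side of the middle of the path, then one of them has strictly more landmarks far
away. There remain vertices on opposite sides with the same largest distance
(`PathFrame.isMResolving_of_opposite`).

* If `ℓ` is odd, such vertices lie in different colour classes of the bipartition of the tree, and
  it suffices that the two classes contain different numbers of landmarks. Adding a path vertex to
  `W` achieves this (`PathFrame.exists_isMResolving_of_odd`).
* If `ℓ > 0` is even, the numbers of landmarks at the largest, second largest and third largest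
  distance are compared. They depend only on the far end of the path, except for one correction
  (`PathFrame.isMResolving_of_even`). At each end either the number of landmarks at depth `1` may
  be varied while keeping that at depth `2`, or there are four branches, or there are two branches
  with two leaves each (`SmallBranches.exists_pair_or_forced`). In the last two cases the
  remaining freedom is in the choice of path vertices, which suffices unless `ℓ = 2` and both ends
  have four branches (`PathFrame.exists_isMResolving_of_even`).
* If `ℓ = 0`, parity reduces the problem to the root against the vertices at depth `2`, and a
  landmark in another branch tells these apart; with a single branch the root is chosen as the
  only landmark (`PathFrame.exists_isMResolving_of_zero`).

For `ℓ > 0`, minimality of the path is needed only to obtain vertices of depth `2` below its two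
ends.
-/

namespace MultisetDim

open SimpleGraph
open scoped Classical

variable {V : Type*} {G : SimpleGraph V}

/-! ### Distances in trees -/

lemma IsTree.dist_adj (hG : G.IsTree) {u v : V} (h : G.Adj u v) (w : V) :
    G.dist u w = G.dist v w + 1 ∨ G.dist v w = G.dist u w + 1 := by
  simpa only [G.dist_comm (u := w)] using hG.dist_eq_dist_add_one_of_adj w h

/-- In a tree, a vertex has at most one neighbour that is closer to a given vertex. -/
lemma IsTree.closer_unique (hG : G.IsTree) {v x y w : V} (hx : G.Adj v x) (hy : G.Adj v y)
    (hxw : G.dist v w = G.dist x w + 1) (hyw : G.dist v w = G.dist y w + 1) : x = y := by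
  obtain ⟨p, hp⟩ := hG.connected.exists_walk_length_eq_dist x w
  obtain ⟨q, hq⟩ := hG.connected.exists_walk_length_eq_dist y w
  have hp' : (Walk.cons hx p).IsPath := Walk.isPath_of_length_eq_dist _ (by simp [hp, hxw])
  have hq' : (Walk.cons hy q).IsPath := Walk.isPath_of_length_eq_dist _ (by simp [hq, hyw])
  have := congrArg Walk.snd ((hG.existsUnique_path v w).unique hp' hq')
  simpa using this

lemma exists_adj_dist_eq (hG : G.Connected) {u w : V} {n : ℕ} (h : G.dist u w = n + 1) :
    ∃ v, G.Adj v w ∧ G.dist u v = n := by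
  obtain ⟨p, hp⟩ := hG.exists_walk_length_eq_dist w u
  rw [G.dist_comm, h] at hp
  cases p with
  | nil => simp at hp
  | @cons _ v _ hv q =>
    refine ⟨v, hv.symm, le_antisymm ?_ ?_⟩
    · rw [G.dist_comm]
      have := G.dist_le q
      simp at hp
      omega
    · have := hG.dist_triangle (u := u) (v := v) (w := w)
      rw [h, dist_eq_one_iff_adj.2 hv.symm] at this
      omega

/-! ### Coordinates along a path of a tree -/

/-- Coordinates on a tree `G` all of whose vertices are at distance at most `2` from the path with
vertices `P 0, …, P ℓ`: the vertex `w` is at distance `dep w` from the path, and `P (idx w)` is the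
path vertex nearest to it. The sum of truncated differences in `dist_P` is `|i - idx w|`. -/
structure PathFrame (G : SimpleGraph V) (ℓ : ℕ) (P : ℕ → V) (idx dep : V → ℕ) : Prop where
  tree : G.IsTree
  idx_le : ∀ w, idx w ≤ ℓ
  dep_le : ∀ w, dep w ≤ 2
  idx_P : ∀ i ≤ ℓ, idx (P i) = i
  dist_P : ∀ i ≤ ℓ, ∀ w, G.dist (P i) w = (i - idx w) + (idx w - i) + dep w

theorem exists_pathFrame (hG : G.IsTree) {a b : V} (p : G.Walk a b) (hp : IsCenterPath G 2 p) :
    ∃ idx dep, PathFrame G p.length p.getVert idx dep := by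
  have hinj : ∀ i ≤ p.length, ∀ j ≤ p.length, p.getVert i = p.getVert j → i = j :=
    fun i hi j hj h => hp.1.getVert_injOn hi hj h
  have hstep : ∀ i < p.length, G.Adj (p.getVert i) (p.getVert (i + 1)) :=
    fun i hi => p.adj_getVert_succ hi
  have key : ∀ w, ∃ i ≤ p.length, G.dist (p.getVert i) w ≤ 2 ∧
      ∀ j ≤ p.length, G.dist (p.getVert j) w = (j - i) + (i - j) + G.dist (p.getVert i) w := by
    intro w
    obtain ⟨i, hi, hmin⟩ := Finset.exists_min_image (Finset.range (p.length + 1))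
      (fun i => G.dist (p.getVert i) w) ⟨0, by simp⟩
    simp only [Finset.mem_range, Nat.lt_succ_iff] at hi hmin
    have up : ∀ k, i + k ≤ p.length → G.dist (p.getVert (i + k)) w
        = k + G.dist (p.getVert i) w := by
      intro k
      induction k using Nat.strong_induction_on with
      | _ k ih =>
        intro hk
        rcases k with _ | _ | k
        · simp
        · have h1 := IsTree.dist_adj hG (hstep i (by omega)) w
          have h2 := hmin (i + 1) hk
          simp only [zero_add]
          omega
        · have h1 := IsTree.dist_adj hG (hstep (i + (k + 1)) (by omega)) w
          have h2 := ih (k + 1) (by omega) (by omega)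
          have h3 := ih k (by omega) (by omega)
          rcases h1 with h1 | h1
          · exfalso
            have := hinj _ (by omega) _ (by omega) (IsTree.closer_unique hG
              (hstep (i + (k + 1)) (by omega)) (hstep (i + k) (by omega)).symm h1
              (by omega))
            omega
          · rw [show i + (k + 1 + 1) = i + (k + 1) + 1 by ring]
            omega
    have down : ∀ k ≤ i, G.dist (p.getVert (i - k)) w = k + G.dist (p.getVert i) w := by
      intro k
      induction k using Nat.strong_induction_on with
      | _ k ih =>
        intro hk
        rcases k with _ | _ | k
        · simp
        · have h0 := hstep (i - 1) (by omega)
          rw [show i - 1 + 1 = i by omega] at h0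
          have h1 := IsTree.dist_adj hG h0 w
          have h2 := hmin (i - 1) (by omega)
          simp only [zero_add]
          omega
        · have h0 := hstep (i - (k + 2)) (by omega)
          have h0' := hstep (i - (k + 1)) (by omega)
          rw [show i - (k + 2) + 1 = i - (k + 1) by omega] at h0
          rw [show i - (k + 1) + 1 = i - k by omega] at h0'
          have h1 := IsTree.dist_adj hG h0 w
          have h2 := ih (k + 1) (by omega) (by omega)
          have h3 := ih k (by omega) (by omega)
          rcases h1 with h1 | h1
          · show G.dist (p.getVert (i - (k + 2))) w = _
            omega
          · exfalso
            have := hinj _ (by omega) _ (by omega)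
              (IsTree.closer_unique hG h0.symm h0' h1 (by omega))
            omega
    refine ⟨i, hi, ?_, ?_⟩
    · obtain ⟨x, hx, hxw⟩ := hp.2 w
      obtain ⟨j, rfl, hj⟩ := Walk.mem_support_iff_exists_getVert.1 hx
      rw [G.dist_comm] at hxw
      exact (hmin j hj).trans hxw
    · intro j hj
      rcases le_total i j with h | h
      · obtain ⟨k, rfl⟩ := Nat.exists_eq_add_of_le h
        rw [up k hj]
        omega
      · have := down (i - j) (by omega)
        rw [show i - (i - j) = j by omega] at this
        omega
  choose idx h1 h2 h3 using key
  refine ⟨idx, fun w => G.dist (p.getVert (idx w)) w, hG, h1, h2, ?_, fun i hi w => h3 w i hi⟩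
  intro i hi
  have := h3 (p.getVert i) i hi
  rw [SimpleGraph.dist_self] at this
  omega

namespace PathFrame

variable {ℓ : ℕ} {P : ℕ → V} {idx dep : V → ℕ}

lemma dep_P (F : PathFrame G ℓ P idx dep) {i : ℕ} (hi : i ≤ ℓ) : dep (P i) = 0 := by
  have := F.dist_P i hi (P i)
  rw [SimpleGraph.dist_self] at this
  omega

lemma dist_root (F : PathFrame G ℓ P idx dep) (w : V) : G.dist (P (idx w)) w = dep w := by
  rw [F.dist_P _ (F.idx_le w)]
  omega

lemma eq_P (F : PathFrame G ℓ P idx dep) {w : V} (h : dep w = 0) : w = P (idx w) := by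
  rw [← F.dist_root w] at h
  exact (F.tree.connected.dist_eq_zero_iff.1 h).symm

lemma adj_P_succ (F : PathFrame G ℓ P idx dep) {i : ℕ} (hi : i < ℓ) :
    G.Adj (P i) (P (i + 1)) := by
  rw [← dist_eq_one_iff_adj, F.dist_P i hi.le, F.idx_P _ hi, F.dep_P hi]
  omega

lemma adj_root (F : PathFrame G ℓ P idx dep) {v : V} (h : dep v = 1) : G.Adj (P (idx v)) v := by
  rw [← dist_eq_one_iff_adj, F.dist_root, h]

lemma exists_parent (F : PathFrame G ℓ P idx dep) {u : V} (h : dep u = 2) :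
    ∃ v, G.Adj v u ∧ dep v = 1 ∧ idx v = idx u := by
  have h2 := F.dist_root u
  rw [h] at h2
  obtain ⟨v, hv, hd⟩ := exists_adj_dist_eq F.tree.connected h2
  have h3 := F.dist_P _ (F.idx_le u) v
  refine ⟨v, hv, ?_⟩
  rcases Nat.eq_zero_or_pos (dep v) with h0 | h0
  · have h4 := F.dist_P _ (F.idx_le v) u
    rw [← F.eq_P h0, dist_eq_one_iff_adj.2 hv] at h4
    omega
  · omega

/-- The vertices beyond the edge from the path to `v` lie within distance `1` of `v`. -/
lemma branch (F : PathFrame G ℓ P idx dep) {v w : V} (h : dep v = 1)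
    (hw : G.dist (P (idx v)) w = G.dist v w + 1) : idx w = idx v ∧ G.dist v w ≤ 1 := by
  have hv := F.adj_root h
  have hl := F.idx_le v
  have hl' := F.idx_le w
  have h1 := F.dist_P _ hl w
  have hd := F.dep_le w
  rcases lt_trichotomy (idx v) (idx w) with hlt | heq | hgt
  · have h2 := F.dist_P (idx v + 1) (by omega) w
    have := IsTree.closer_unique F.tree hv (F.adj_P_succ (by omega)) hw (by omega)
    rw [this, F.dep_P (by omega)] at h
    omega
  · omega
  · have h2 := F.dist_P (idx v - 1) (by omega) w
    have h3 := F.adj_P_succ (i := idx v - 1) (by omega)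
    rw [Nat.sub_add_cancel (by omega)] at h3
    have := IsTree.closer_unique F.tree hv h3.symm hw (by omega)
    rw [this, F.dep_P (by omega)] at h
    omega

lemma adj_of_dep_one (F : PathFrame G ℓ P idx dep) {v w : V} (h : dep v = 1) :
    G.Adj v w ↔ w = P (idx v) ∨ G.Adj v w ∧ dep w = 2 ∧ idx w = idx v := by
  constructor
  · intro hw
    have h1 := IsTree.dist_adj F.tree (F.adj_root h) w
    rw [dist_eq_one_iff_adj.2 hw] at h1
    rcases h1 with h1 | h1
    · have h2 := F.branch h (by rw [dist_eq_one_iff_adj.2 hw, h1])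
      have h3 := F.dist_root w
      rw [h2.1, h1] at h3
      exact Or.inr ⟨hw, h3.symm, h2.1⟩
    · exact Or.inl (F.tree.connected.dist_eq_zero_iff.1 (by omega)).symm
  · rintro (rfl | h')
    · exact (F.adj_root h).symm
    · exact h'.1

lemma parent_unique (F : PathFrame G ℓ P idx dep) {u v v' : V} (hu : dep u = 2) (hv : dep v = 1)
    (hv' : dep v' = 1) (h : G.Adj v u) (h' : G.Adj v' u) : v = v' := by
  have h1 : idx u = idx v := by
    rcases (F.adj_of_dep_one hv).1 h with h1 | h1
    · rw [h1, F.dep_P (F.idx_le v)] at hu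
      omega
    · exact h1.2.2
  have h2 : idx u = idx v' := by
    rcases (F.adj_of_dep_one hv').1 h' with h1 | h1
    · rw [h1, F.dep_P (F.idx_le v')] at hu
      omega
    · exact h1.2.2
  have h3 := F.dist_root u
  have h4 := F.dist_root v
  have h5 := F.dist_root v'
  rw [← h1] at h4
  rw [← h2] at h5
  rw [G.dist_comm] at h3 h4 h5
  exact IsTree.closer_unique F.tree (w := P (idx u)) h.symm h'.symm (by omega) (by omega)

lemma dist_of_branch (F : PathFrame G ℓ P idx dep) {v w : V} (h : dep v = 1) :
    (w = v ∨ (G.Adj v w ∧ dep w = 2)) ∧ G.dist (P (idx v)) w = G.dist v w + 1 ∨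
    ¬ (w = v ∨ (G.Adj v w ∧ dep w = 2)) ∧ G.dist v w = G.dist (P (idx v)) w + 1 := by
  rcases IsTree.dist_adj F.tree (F.adj_root h) w with h1 | h1
  · refine Or.inl ⟨?_, h1⟩
    obtain ⟨h2, h3⟩ := F.branch h h1
    have h4 := F.dist_root w
    rw [h2] at h4
    rcases Nat.eq_zero_or_pos (G.dist v w) with h0 | h0
    · exact Or.inl (F.tree.connected.dist_eq_zero_iff.1 h0).symm
    · exact Or.inr ⟨dist_eq_one_iff_adj.1 (by omega), by omega⟩
  · refine Or.inr ⟨?_, h1⟩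
    rintro (rfl | ⟨h2, h3⟩)
    · rw [SimpleGraph.dist_self, F.dist_root] at h1
      omega
    · have h4 : idx w = idx v := by
        rcases (F.adj_of_dep_one h).1 h2 with h5 | h5
        · rw [h5, F.dep_P (F.idx_le v)] at h3
          omega
        · exact h5.2.2
      rw [← h4, F.dist_root, dist_eq_one_iff_adj.2 h2] at h1
      omega

lemma dist_of_leaf (F : PathFrame G ℓ P idx dep) {u v w : V} (hu : dep u = 2) (hv : dep v = 1)
    (h : G.Adj v u) (hw : w ≠ u) : G.dist u w = G.dist v w + 1 := by
  rcases IsTree.dist_adj F.tree h w with h1 | h1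
  · exfalso
    apply hw
    have hP := F.adj_root hv
    rcases IsTree.dist_adj F.tree hP w with h2 | h2
    · have := (F.branch hv h2).2
      exact (F.tree.connected.dist_eq_zero_iff.1 (by omega)).symm
    · have := IsTree.closer_unique F.tree h hP.symm h1 h2
      rw [this, F.dep_P (F.idx_le v)] at hu
      omega
  · exact h1

lemma dist_le (F : PathFrame G ℓ P idx dep) (u w : V) :
    G.dist u w ≤ dep u + ((idx u - idx w) + (idx w - idx u)) + dep w := by
  have h := F.tree.connected.dist_triangle (u := u) (v := P (idx u)) (w := w)
  rw [G.dist_comm (v := P (idx u)), F.dist_root, F.dist_P _ (F.idx_le u)] at h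
  omega

lemma dist_eq (F : PathFrame G ℓ P idx dep) {u w : V} (h : idx u ≠ idx w) :
    G.dist u w = dep u + ((idx u - idx w) + (idx w - idx u)) + dep w := by
  have h1 := F.dist_P _ (F.idx_le u) w
  have hd := F.dep_le u
  obtain h0 | h0 | h0 : dep u = 0 ∨ dep u = 1 ∨ dep u = 2 := by omega
  · rw [← F.eq_P h0] at h1
    omega
  · rcases IsTree.dist_adj F.tree (F.adj_root h0) w with h2 | h2
    · exact absurd (F.branch h0 h2).1.symm h
    · omega
  · obtain ⟨v, hv, hv1, hvi⟩ := F.exists_parent h0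
    rw [F.dist_of_leaf h0 hv1 hv (by rintro rfl; exact h rfl)]
    rcases IsTree.dist_adj F.tree (F.adj_root hv1) w with h2 | h2
    · exact absurd ((F.branch hv1 h2).1.trans hvi).symm h
    · rw [hvi] at h2
      omega

lemma dist_parity (F : PathFrame G ℓ P idx dep) (u w : V) :
    (G.dist u w + (idx u + dep u) + (idx w + dep w)) % 2 = 0 := by
  have h1 := F.dist_P _ (F.idx_le u) w
  have hd := F.dep_le u
  obtain h0 | h0 | h0 : dep u = 0 ∨ dep u = 1 ∨ dep u = 2 := by omega
  · rw [← F.eq_P h0] at h1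
    omega
  · rcases IsTree.dist_adj F.tree (F.adj_root h0) w with h2 | h2 <;> omega
  · obtain ⟨v, hv, hv1, hvi⟩ := F.exists_parent h0
    have h3 := F.adj_root hv1
    rw [hvi] at h3
    rcases IsTree.dist_adj F.tree h3 w with h2 | h2 <;>
    rcases IsTree.dist_adj F.tree hv w with h2 | h2 <;> omega

end PathFrame

/-! ### Counting landmarks at a given distance -/

theorem multisetDim_ne_top_iff : multisetDim G ≠ ⊤ ↔ ∃ W : Finset V, IsMResolving G W := by
  simp [multisetDim, iInf_eq_top]

lemma repMultiset_eq_iff {W : Finset V} {u v : V} :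
    repMultiset G W u = repMultiset G W v ↔
      ∀ k, (W.filter fun w => G.dist u w = k).card = (W.filter fun w => G.dist v w = k).card := by
  have key : ∀ u k, (repMultiset G W u).count k = (W.filter fun w => G.dist u w = k).card := by
    intro u k
    rw [repMultiset, Multiset.count_map, Finset.card_def, Finset.filter_val]
    simp only [eq_comm]
  simp only [Multiset.ext, key]

lemma card_filter_dist_eq {W : Finset V} {u v : V} (h : repMultiset G W u = repMultiset G W v)
    (Q : ℕ → Prop) [DecidablePred Q] :
    (W.filter fun w => Q (G.dist u w)).card = (W.filter fun w => Q (G.dist v w)).card := by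
  have key : ∀ u, (repMultiset G W u).countP Q = (W.filter fun w => Q (G.dist u w)).card := by
    intro u
    rw [repMultiset, Multiset.countP_map, Finset.card_def, Finset.filter_val]
  rw [← key, ← key, h]

lemma exists_dist_eq {W : Finset V} {u v w : V} (h : repMultiset G W u = repMultiset G W v)
    (hw : w ∈ W) : ∃ w' ∈ W, G.dist v w' = G.dist u w := by
  have h1 : G.dist u w ∈ repMultiset G W u := Multiset.mem_map_of_mem _ hw
  rw [h] at h1
  obtain ⟨w', hw', h2⟩ := Multiset.mem_map.1 h1
  exact ⟨w', hw', h2⟩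

/-! ### Children and leaves -/

section Kids

variable [Fintype V]

/-- The children of the `i`-th path vertex: its neighbours off the path. -/
noncomputable def kids (idx dep : V → ℕ) (i : ℕ) : Finset V :=
  Finset.univ.filter fun v => idx v = i ∧ dep v = 1

/-- The vertices at depth `2` that are adjacent to `v`. -/
noncomputable def leaves (G : SimpleGraph V) (dep : V → ℕ) (v : V) : Finset V :=
  Finset.univ.filter fun x => G.Adj v x ∧ dep x = 2

@[simp] lemma mem_kids {idx dep : V → ℕ} {i : ℕ} {v : V} :
    v ∈ kids idx dep i ↔ idx v = i ∧ dep v = 1 := by simp [kids]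

@[simp] lemma mem_leaves {dep : V → ℕ} {v x : V} :
    x ∈ leaves G dep v ↔ G.Adj v x ∧ dep x = 2 := by simp [leaves]

/-- There are at most four branches, `k v` being the number of leaves of the branch of `v ∈ K`: all
branches have at most two leaves, at most two have none, and at most two have two. -/
def SmallBranches (K : Finset V) (k : V → ℕ) : Prop :=
  K.card ≤ 4 ∧ (∀ v ∈ K, k v ≤ 2) ∧ (K.filter fun v => k v = 0).card ≤ 2 ∧
    (K.filter fun v => k v = 2).card ≤ 2

namespace PathFrame

variable {ℓ : ℕ} {P : ℕ → V} {idx dep : V → ℕ}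

lemma idx_of_mem_leaves (F : PathFrame G ℓ P idx dep) {v x : V} (hv : dep v = 1)
    (hx : x ∈ leaves G dep v) : idx x = idx v := by
  rw [mem_leaves] at hx
  rcases (F.adj_of_dep_one hv).1 hx.1 with h | h
  · rw [h, F.dep_P (F.idx_le v)] at hx
    omega
  · exact h.2.2

/-- The landmark counts at a child `v` are those at its path vertex, shifted by one, up to a
correction that depends only on `v ∈ W` and on the number of landmarks among the leaves of `v`. -/
lemma card_dist_kid (F : PathFrame G ℓ P idx dep) (W : Finset V) {v : V} (hv : dep v = 1) (k : ℕ) :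
    ((W.filter fun w => G.dist v w = k).card : ℤ) =
      (W.filter fun w => G.dist (P (idx v)) w + 1 = k).card +
      (if v ∈ W then (if 0 = k then 1 else 0) - (if 2 = k then 1 else 0) else 0) +
      (W ∩ leaves G dep v).card * ((if 1 = k then 1 else 0) - (if 3 = k then 1 else 0)) := by
  have hpt : ∀ w, (if G.dist v w = k then 1 else 0 : ℤ) =
      (if G.dist (P (idx v)) w + 1 = k then 1 else 0) +
      (if v = w then (if 0 = k then 1 else 0) - (if 2 = k then 1 else 0) else 0) +
      (if w ∈ leaves G dep v then (if 1 = k then 1 else 0) - (if 3 = k then 1 else 0) else 0) := by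
    intro w
    simp only [mem_leaves]
    rcases F.dist_of_branch (w := w) hv with ⟨rfl | h1, h2⟩ | ⟨h1, h2⟩
    · simp [h2]
    · have h3 : v ≠ w := by rintro rfl; exact G.irrefl h1.1
      rw [h2, dist_eq_one_iff_adj.2 h1.1]
      simp [h1, h3]
    · rw [not_or] at h1
      rw [if_neg (Ne.symm h1.1), if_neg h1.2, h2]
      simp
  have hsum : ∀ c : ℤ, ∑ w ∈ W, (if w ∈ leaves G dep v then c else 0) =
      (W ∩ leaves G dep v).card * c := by
    intro c
    rw [← Finset.sum_filter, Finset.filter_mem_eq_inter, Finset.sum_const, nsmul_eq_mul]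
  rw [Finset.card_filter, Finset.card_filter]
  push_cast
  rw [Finset.sum_congr rfl fun w _ => hpt w, Finset.sum_add_distrib, Finset.sum_add_distrib,
    Finset.sum_ite_eq, hsum]

lemma card_dist_leaf (F : PathFrame G ℓ P idx dep) (W : Finset V) {v x : V} (hv : dep v = 1)
    (hx : x ∈ leaves G dep v) (k : ℕ) :
    ((W.filter fun w => G.dist x w = k).card : ℤ) =
      (W.filter fun w => G.dist v w + 1 = k).card +
      (if x ∈ W then (if 0 = k then 1 else 0) - (if 2 = k then 1 else 0) else 0) := by
  rw [mem_leaves] at hx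
  have hpt : ∀ w, (if G.dist x w = k then 1 else 0 : ℤ) =
      (if G.dist v w + 1 = k then 1 else 0) +
      (if x = w then (if 0 = k then 1 else 0) - (if 2 = k then 1 else 0) else 0) := by
    intro w
    by_cases h : x = w
    · subst h
      rw [dist_eq_one_iff_adj.2 hx.1]
      simp
    · rw [F.dist_of_leaf hx.2 hv hx.1 (Ne.symm h)]
      simp [h]
  rw [Finset.card_filter, Finset.card_filter]
  push_cast
  rw [Finset.sum_congr rfl fun w _ => hpt w, Finset.sum_add_distrib, Finset.sum_ite_eq]

/-! ### Necessity -/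

/-- Two leaves of the same child that both lie in `W`, or both outside `W`, see the same distances.
Neither are two children of the same path vertex told apart if `W` contains both or none of them,
and equally many of their leaves. As the latter number is at most one, this leaves four labels for
the children. -/
theorem smallBranches_of_isMResolving (F : PathFrame G ℓ P idx dep) {W : Finset V}
    (hW : IsMResolving G W) (i : ℕ) :
    SmallBranches (kids idx dep i) fun v => (leaves G dep v).card := by
  have hleaf : ∀ v, dep v = 1 → ∀ x ∈ leaves G dep v, ∀ y ∈ leaves G dep v,
      (x ∈ W ↔ y ∈ W) → x = y := by
    intro v hv x hx y hy hxy
    by_contra hne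
    refine hW x y hne (repMultiset_eq_iff.2 fun k => ?_)
    have h1 := F.card_dist_leaf W hv hx k
    have h2 := F.card_dist_leaf W hv hy k
    simp only [hxy] at h1
    exact_mod_cast h1.trans h2.symm
  have hin : ∀ v, dep v = 1 → (W ∩ leaves G dep v).card ≤ 1 := by
    intro v hv
    rw [Finset.card_le_one]
    intro x hx y hy
    rw [Finset.mem_inter] at hx hy
    exact hleaf v hv x hx.2 y hy.2 ⟨fun _ => hy.1, fun _ => hx.1⟩
  have hout : ∀ v, dep v = 1 → (leaves G dep v \ W).card ≤ 1 := by
    intro v hv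
    rw [Finset.card_le_one]
    intro x hx y hy
    rw [Finset.mem_sdiff] at hx hy
    exact hleaf v hv x hx.1 y hy.1 ⟨fun h => absurd h hx.2, fun h => absurd h hy.2⟩
  have hsum : ∀ v, (W ∩ leaves G dep v).card + (leaves G dep v \ W).card
      = (leaves G dep v).card := by
    intro v
    rw [Finset.inter_comm]
    exact Finset.card_inter_add_card_sdiff _ _
  let φ : V → Bool × Bool := fun v => (decide (v ∈ W), decide ((W ∩ leaves G dep v).card = 1))
  have hφ : Set.InjOn φ (kids idx dep i) := by
    intro v hv v' hv' h
    rw [Finset.mem_coe, mem_kids] at hv hv'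
    simp only [φ, Prod.mk.injEq, decide_eq_decide] at h
    have ht : (W ∩ leaves G dep v).card = (W ∩ leaves G dep v').card := by
      have h1 := hin v hv.2
      have h2 := hin v' hv'.2
      have h3 := h.2
      omega
    by_contra hne
    refine hW v v' hne (repMultiset_eq_iff.2 fun k => ?_)
    have h1 := F.card_dist_kid W hv.2 k
    have h2 := F.card_dist_kid W hv'.2 k
    rw [hv.1] at h1
    rw [hv'.1] at h2
    simp only [h.1, ht] at h1
    exact_mod_cast h1.trans h2.symm
  refine ⟨?_, ?_, ?_, ?_⟩
  · simpa using Finset.card_le_card_of_injOn φ (t := Finset.univ) (fun _ _ => Finset.mem_univ _) hφ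
  · intro v hv
    rw [mem_kids] at hv
    have h1 := hin v hv.2
    have h2 := hout v hv.2
    have h3 := hsum v
    show (leaves G dep v).card ≤ 2
    omega
  · refine (Finset.card_le_card_of_injOn φ (t := {(false, false), (true, false)}) ?_
      (hφ.mono (Finset.coe_subset.2 (Finset.filter_subset _ _)))).trans (by simp)
    intro v hv
    simp only [Finset.coe_filter, Set.mem_ofPred_eq] at hv
    have h3 := hsum v
    have : φ v = (decide (v ∈ W), false) := by
      simp only [φ, Prod.mk.injEq, decide_eq_false_iff_not, true_and]
      omega
    rw [this]
    cases decide (v ∈ W) <;> simp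
  · refine (Finset.card_le_card_of_injOn φ (t := {(false, true), (true, true)}) ?_
      (hφ.mono (Finset.coe_subset.2 (Finset.filter_subset _ _)))).trans (by simp)
    intro v hv
    simp only [Finset.coe_filter, Set.mem_ofPred_eq, mem_kids] at hv
    have h1 := hin v hv.1.2
    have h2 := hout v hv.1.2
    have h3 := hsum v
    have : φ v = (decide (v ∈ W), true) := by
      simp only [φ, Prod.mk.injEq, decide_eq_true_iff, true_and]
      omega
    rw [this]
    cases decide (v ∈ W) <;> simp

end PathFrame

end Kids

/-! ### Criteria for a landmark set to be m-resolving -/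

/-- `W` tells apart the leaves of every child, and any two children of the same path vertex carry
different labels: the label of `v` records whether `v ∈ W` and how many of its leaves are in `W`. -/
structure Separates [Fintype V] (G : SimpleGraph V) (idx dep : V → ℕ) (W : Finset V) : Prop where
  leaf : ∀ v, dep v = 1 → ∀ x ∈ leaves G dep v, ∀ y ∈ leaves G dep v, (x ∈ W ↔ y ∈ W) → x = y
  kid : ∀ v v', dep v = 1 → dep v' = 1 → idx v = idx v' → (v ∈ W ↔ v' ∈ W) →
    (W ∩ leaves G dep v).card = (W ∩ leaves G dep v').card → v = v'

/-- The number of landmarks of index `m` and depth `d`. -/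
noncomputable def levelCard (idx dep : V → ℕ) (W : Finset V) (m d : ℕ) : ℕ :=
  (W.filter fun w => idx w = m ∧ dep w = d).card

lemma mem_iff_of_repMultiset_eq (hG : G.Connected) {W : Finset V} {u v : V}
    (h : repMultiset G W u = repMultiset G W v) : u ∈ W ↔ v ∈ W := by
  have key : ∀ u v, repMultiset G W u = repMultiset G W v → u ∈ W → v ∈ W := by
    intro u v h hu
    obtain ⟨w, hw, h1⟩ := exists_dist_eq h hu
    rw [SimpleGraph.dist_self, hG.dist_eq_zero_iff] at h1
    rwa [h1]
  exact ⟨key u v h, key v u h.symm⟩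

namespace PathFrame

variable {ℓ : ℕ} {P : ℕ → V} {idx dep : V → ℕ} {W : Finset V}

lemma repMultiset_kid_of_leaf [Fintype V] (F : PathFrame G ℓ P idx dep) {u u' v v' : V}
    (hv : dep v = 1) (hv' : dep v' = 1)
    (hu : u ∈ leaves G dep v) (hu' : u' ∈ leaves G dep v')
    (h : repMultiset G W u = repMultiset G W u') :
    repMultiset G W v = repMultiset G W v' := by
  rw [repMultiset_eq_iff]
  intro k
  have h1 := F.card_dist_leaf W hv hu (k + 1)
  have h2 := F.card_dist_leaf W hv' hu' (k + 1)
  rw [repMultiset_eq_iff.1 h (k + 1), h2] at h1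
  simp only [mem_iff_of_repMultiset_eq F.tree.connected h, add_left_inj] at h1
  exact_mod_cast h1.symm

lemma card_dist_one [Fintype V] (F : PathFrame G ℓ P idx dep) (W : Finset V) {v : V}
    (hv : dep v = 1) :
    (W.filter fun w => G.dist v w = 1).card =
      (if P (idx v) ∈ W then 1 else 0) + (W ∩ leaves G dep v).card := by
  have h1 := F.card_dist_kid W hv 1
  have h2 : (W.filter fun w => G.dist (P (idx v)) w + 1 = 1).card =
      if P (idx v) ∈ W then 1 else 0 := by
    simp only [Nat.add_eq_right, F.tree.connected.dist_eq_zero_iff]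
    rw [Finset.filter_eq]
    split <;> simp
  rw [h2] at h1
  simp only [zero_ne_one, if_false, OfNat.ofNat_ne_one, sub_zero, if_true, ite_self, add_zero,
    mul_one] at h1
  exact_mod_cast h1

lemma eq_of_same_level [Fintype V] (F : PathFrame G ℓ P idx dep) (hs : Separates G idx dep W)
    {u v : V} (hi : idx u = idx v) (hd : dep u = dep v)
    (h : repMultiset G W u = repMultiset G W v) : u = v := by
  have kid : ∀ u v, idx u = idx v → dep u = 1 → dep v = 1 →
      repMultiset G W u = repMultiset G W v → u = v := by
    intro u v hi hu hv h
    refine hs.kid u v hu hv hi (mem_iff_of_repMultiset_eq F.tree.connected h) ?_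
    have h1 := F.card_dist_one W hu
    have h2 := F.card_dist_one W hv
    rw [hi] at h1
    rw [repMultiset_eq_iff.1 h 1] at h1
    omega
  have hd2 := F.dep_le u
  obtain h0 | h0 | h0 : dep u = 0 ∨ dep u = 1 ∨ dep u = 2 := by omega
  · rw [F.eq_P h0, F.eq_P (hd ▸ h0 : dep v = 0), hi]
  · exact kid u v hi h0 (hd ▸ h0) h
  · obtain ⟨x, hx, hx1, hxi⟩ := F.exists_parent h0
    obtain ⟨y, hy, hy1, hyi⟩ := F.exists_parent (hd ▸ h0 : dep v = 2)
    have hu : u ∈ leaves G dep x := mem_leaves.2 ⟨hx, h0⟩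
    have hv : v ∈ leaves G dep y := mem_leaves.2 ⟨hy, hd ▸ h0⟩
    have hxy := kid x y (by omega) hx1 hy1 (F.repMultiset_kid_of_leaf hx1 hy1 hu hv h)
    subst hxy
    exact hs.leaf x hx1 u hu v hv (mem_iff_of_repMultiset_eq F.tree.connected h)

/-- The same coordinates, with the path traversed backwards. -/
lemma reverse (F : PathFrame G ℓ P idx dep) :
    PathFrame G ℓ (fun i => P (ℓ - i)) (fun w => ℓ - idx w) dep where
  tree := F.tree
  idx_le _ := Nat.sub_le _ _
  dep_le := F.dep_le
  idx_P i hi := by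
    rw [F.idx_P _ (Nat.sub_le _ _)]
    omega
  dist_P i hi w := by
    rw [F.dist_P _ (Nat.sub_le _ _)]
    have := F.idx_le w
    omega

/-- If there are landmarks at depth `2` below both ends, then they attain the largest distance from
any vertex `u` to a landmark, which is `dep u + 2 + max (idx u) (ℓ - idx u)`. So vertices seeing the
same distances agree in this number; one of the two inequalities is stated. -/
lemma ecc_le (F : PathFrame G ℓ P idx dep) (hℓ : 0 < ℓ)
    (h0 : ∃ w ∈ W, idx w = 0 ∧ dep w = 2) (h1 : ∃ w ∈ W, idx w = ℓ ∧ dep w = 2) {u v : V}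
    (h : repMultiset G W u = repMultiset G W v) :
    dep u + (ℓ - idx u) ≤ dep v + max (idx v) (ℓ - idx v) ∧
    dep u + idx u ≤ dep v + max (idx v) (ℓ - idx v) := by
  have hu := F.idx_le u
  have hv := F.idx_le v
  obtain ⟨x, hx, hx0, hx2⟩ := h0
  obtain ⟨y, hy, hy0, hy2⟩ := h1
  obtain ⟨x', hx', hxd⟩ := exists_dist_eq h hx
  obtain ⟨y', hy', hyd⟩ := exists_dist_eq h hy
  have e1 := F.dist_le v x'
  have e2 := F.dist_le v y'
  have e3 := F.dep_le x'
  have e4 := F.dep_le y'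
  have e5 := F.idx_le x'
  have e6 := F.idx_le y'
  have e7 : idx u ≠ 0 → G.dist u x = dep u + idx u + 2 := by
    intro hne
    rw [F.dist_eq (by omega)]
    omega
  have e8 : idx u ≠ ℓ → G.dist u y = dep u + (ℓ - idx u) + 2 := by
    intro hne
    rw [F.dist_eq (by omega)]
    omega
  omega

/-- On one side of the middle of the path, two vertices of equal eccentricity and different index
are told apart by the landmarks at distance at least `dep u + (ℓ - idx u) + 2`: the vertex `u`
closer to the near end has more of them. -/
lemma not_repMultiset_eq_of_same_side (F : PathFrame G ℓ P idx dep)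
    (h1 : ∃ w ∈ W, idx w = ℓ ∧ dep w = 2) {u v : V}
    (huv : idx u < idx v) (hd : dep u + idx u = dep v + idx v) :
    repMultiset G W u ≠ repMultiset G W v := by
  intro h
  have hu := F.idx_le u
  have hv := F.idx_le v
  have hu2 := F.dep_le u
  obtain ⟨y, hy, hy0, hy2⟩ := h1
  have hc := card_filter_dist_eq h fun d => dep u + (ℓ - idx u) + 2 ≤ d
  refine absurd hc (ne_of_gt (Finset.card_lt_card ⟨?_, ?_⟩))
  · intro w hw
    rw [Finset.mem_filter] at hw ⊢
    refine ⟨hw.1, ?_⟩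
    have e1 := F.dist_le v w
    have e2 := F.dep_le w
    have e3 := F.idx_le w
    by_cases hi : idx u = idx w
    · omega
    · rw [F.dist_eq hi]
      omega
  · intro hsub
    have e1 := F.dist_eq (u := u) (w := y) (by omega)
    have e2 := F.dist_le v y
    have := hsub (Finset.mem_filter.2 ⟨hy, by omega⟩)
    rw [Finset.mem_filter] at this
    omega

/-- It suffices to tell apart vertices on opposite sides of the middle of the path. -/
theorem isMResolving_of_opposite [Fintype V] (F : PathFrame G ℓ P idx dep) (hℓ : 0 < ℓ)
    (hs : Separates G idx dep W)
    (h0 : ∃ w ∈ W, idx w = 0 ∧ dep w = 2) (h1 : ∃ w ∈ W, idx w = ℓ ∧ dep w = 2)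
    (hopp : ∀ u v, 2 * idx u < ℓ → ℓ < 2 * idx v → dep u + (ℓ - idx u) = dep v + idx v →
      repMultiset G W u ≠ repMultiset G W v) : IsMResolving G W := by
  have key : ∀ u v, idx u < idx v → repMultiset G W u ≠ repMultiset G W v := by
    intro u v hlt h
    have hu := F.idx_le u
    have hv := F.idx_le v
    have e1 := F.ecc_le hℓ h0 h1 h
    have e2 := F.ecc_le hℓ h0 h1 h.symm
    by_cases hu' : 2 * idx u < ℓ
    · by_cases hv' : ℓ < 2 * idx v
      · exact hopp u v hu' hv' (by omega) h
      · refine F.reverse.not_repMultiset_eq_of_same_side (W := W) ?_ (u := v) (v := u)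
          (by omega) (by omega) h.symm
        obtain ⟨x, hx, hx0, hx2⟩ := h0
        exact ⟨x, hx, by omega, hx2⟩
    · exact F.not_repMultiset_eq_of_same_side h1 hlt (by omega) h
  intro u v hne h
  rcases lt_trichotomy (idx u) (idx v) with hlt | heq | hgt
  · exact key u v hlt h
  · refine hne (F.eq_of_same_level hs heq ?_ h)
    have e1 := F.ecc_le hℓ h0 h1 h
    have e2 := F.ecc_le hℓ h0 h1 h.symm
    omega
  · exact key v u hgt h.symm

/-- Unequally many landmarks in the two colour classes of the bipartition make the vertices of
different colours distinguishable. -/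
lemma parity_eq_of_repMultiset_eq (F : PathFrame G ℓ P idx dep)
    (hW : (W.filter fun w => (idx w + dep w) % 2 = 0).card ≠
      (W.filter fun w => (idx w + dep w) % 2 = 1).card) {u v : V}
    (h : repMultiset G W u = repMultiset G W v) :
    (idx u + dep u) % 2 = (idx v + dep v) % 2 := by
  have key : ∀ u, (W.filter fun w => G.dist u w % 2 = 0).card =
      (W.filter fun w => (idx w + dep w) % 2 = (idx u + dep u) % 2).card := by
    intro u
    congr 1
    refine Finset.filter_congr fun w _ => ?_
    have := F.dist_parity u w
    omega
  have hc := card_filter_dist_eq h fun d => d % 2 = 0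
  rw [key, key] at hc
  have h2 := Nat.mod_two_eq_zero_or_one (idx u + dep u)
  have h3 := Nat.mod_two_eq_zero_or_one (idx v + dep v)
  rcases h2 with h2 | h2 <;> rcases h3 with h3 | h3
  · omega
  · rw [h2, h3] at hc
    exact absurd hc hW
  · rw [h2, h3] at hc
    exact absurd hc.symm hW
  · omega

/-- For a path of odd length, vertices on opposite sides with the same eccentricity have different
colours. -/
theorem isMResolving_of_odd [Fintype V] (F : PathFrame G ℓ P idx dep) (hℓ : ℓ % 2 = 1)
    (hs : Separates G idx dep W)
    (h0 : ∃ w ∈ W, idx w = 0 ∧ dep w = 2) (h1 : ∃ w ∈ W, idx w = ℓ ∧ dep w = 2)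
    (hW : (W.filter fun w => (idx w + dep w) % 2 = 0).card ≠
      (W.filter fun w => (idx w + dep w) % 2 = 1).card) : IsMResolving G W := by
  refine F.isMResolving_of_opposite (by omega) hs h0 h1 fun u v hu hv hd h => ?_
  have := F.parity_eq_of_repMultiset_eq hW h
  omega

lemma card_filter_or_eq {p q : V → Prop} [DecidablePred p] [DecidablePred q]
    (h : ∀ w, p w → ¬ q w) :
    (W.filter fun w => p w ∨ q w).card = (W.filter p).card + (W.filter q).card := by
  rw [Finset.filter_or, Finset.card_union_of_disjoint]
  rw [Finset.disjoint_filter]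
  exact fun w _ => h w

/-- From a vertex in the first half of the path, the landmarks at the largest and at the second
largest possible distance all lie below the last two path vertices. -/
lemma card_far_zero (F : PathFrame G ℓ P idx dep) {u : V} (hu : 2 * idx u < ℓ) :
    (W.filter fun w => G.dist u w = dep u + (ℓ - idx u) + 2).card = levelCard idx dep W ℓ 2 := by
  rw [levelCard]
  congr 1
  refine Finset.filter_congr fun w _ => ?_
  have e1 := F.dep_le w
  have e2 := F.idx_le w
  by_cases hi : idx u = idx w
  · have := F.dist_le u w
    omega
  · rw [F.dist_eq hi]
    omega

lemma card_far_one (F : PathFrame G ℓ P idx dep) {u : V} (hu : 2 * idx u + 2 ≤ ℓ) :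
    (W.filter fun w => G.dist u w = dep u + (ℓ - idx u) + 1).card =
      levelCard idx dep W ℓ 1 + levelCard idx dep W (ℓ - 1) 2 := by
  rw [levelCard, levelCard, ← card_filter_or_eq (by intros; omega)]
  congr 1
  refine Finset.filter_congr fun w _ => ?_
  have e1 := F.dep_le w
  have e2 := F.idx_le w
  by_cases hi : idx u = idx w
  · have := F.dist_le u w
    omega
  · rw [F.dist_eq hi]
    omega

/-- The last summand stems from the near end, which is only seen at this distance if `u` is next to
the middle vertex. -/
lemma card_far_two (F : PathFrame G ℓ P idx dep) (hℓ : 4 ≤ ℓ) {u : V} (hu : 2 * idx u + 2 ≤ ℓ) :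
    (W.filter fun w => G.dist u w = dep u + (ℓ - idx u)).card =
      levelCard idx dep W ℓ 0 + levelCard idx dep W (ℓ - 1) 1 + levelCard idx dep W (ℓ - 2) 2 +
        if 2 * idx u + 2 = ℓ then levelCard idx dep W 0 2 else 0 := by
  have : (if 2 * idx u + 2 = ℓ then levelCard idx dep W 0 2 else 0) =
      (W.filter fun w => 2 * idx u + 2 = ℓ ∧ idx w = 0 ∧ dep w = 2).card := by
    split_ifs with h <;> simp [h, levelCard]
  rw [this, levelCard, levelCard, levelCard, ← card_filter_or_eq (by intros; omega),
    ← card_filter_or_eq (by intros; omega), ← card_filter_or_eq (by intros; omega)]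
  congr 1
  refine Finset.filter_congr fun w _ => ?_
  have e1 := F.dep_le w
  have e2 := F.idx_le w
  by_cases hi : idx u = idx w
  · have := F.dist_le u w
    omega
  · rw [F.dist_eq hi]
    omega

lemma levelCard_reverse (F : PathFrame G ℓ P idx dep) {m : ℕ} (hm : m ≤ ℓ) (d : ℕ) :
    levelCard (fun w => ℓ - idx w) dep W m d = levelCard idx dep W (ℓ - m) d := by
  rw [levelCard, levelCard]
  congr 1
  refine Finset.filter_congr fun w _ => ?_
  have e2 := F.idx_le w
  omega

/-- For a path of even length, the far ends as seen from vertices on opposite sides are compared: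
it suffices that they differ in the number of landmarks at the largest possible distance, in that at
the second largest, or by a suitable amount in that at the third largest. -/
theorem isMResolving_of_even [Fintype V] (F : PathFrame G ℓ P idx dep) (hℓ : 0 < ℓ)
    (heven : ℓ % 2 = 0) (hs : Separates G idx dep W)
    (h0 : ∃ w ∈ W, idx w = 0 ∧ dep w = 2) (h1 : ∃ w ∈ W, idx w = ℓ ∧ dep w = 2)
    (n : ℕ → ℕ → ℕ) (hn : ∀ m d, levelCard idx dep W m d = n m d)
    (hW : n ℓ 2 = n 0 2 → n ℓ 1 + n (ℓ - 1) 2 = n 0 1 + n 1 2 → 4 ≤ ℓ ∧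
      n ℓ 0 + n (ℓ - 1) 1 + n (ℓ - 2) 2 ≠ n 0 0 + n 1 1 + n 2 2 ∧
      n ℓ 0 + n (ℓ - 1) 1 + n (ℓ - 2) 2 ≠ n 0 0 + n 1 1 + n 2 2 + n 0 2 ∧
      n ℓ 0 + n (ℓ - 1) 1 + n (ℓ - 2) 2 + n 0 2 ≠ n 0 0 + n 1 1 + n 2 2) :
    IsMResolving G W := by
  refine F.isMResolving_of_opposite hℓ hs h0 h1 fun u v hu hv hd h => ?_
  have hv' := F.idx_le v
  have hr : ∀ m ≤ ℓ, ∀ d, levelCard (fun w => ℓ - idx w) dep W m d = n (ℓ - m) d := by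
    intro m hm d
    rw [F.levelCard_reverse hm, hn]
  have hvv : ℓ - (ℓ - idx v) = idx v := by omega
  have a0 := F.card_far_zero (W := W) hu
  have b0 := F.reverse.card_far_zero (W := W) (u := v) (by omega)
  have a1 := F.card_far_one (W := W) (u := u) (by omega)
  have b1 := F.reverse.card_far_one (W := W) (u := v) (by omega)
  rw [repMultiset_eq_iff.1 h, hd, hn] at a0
  rw [repMultiset_eq_iff.1 h, hd, hn, hn] at a1
  rw [hvv, hr _ le_rfl, Nat.sub_self] at b0
  rw [hvv, hr _ le_rfl, hr _ (by omega), Nat.sub_self, Nat.sub_sub_self (by omega)] at b1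
  have hW' := hW (by omega) (by omega)
  have a2 := F.card_far_two (W := W) hW'.1 (u := u) (by omega)
  have b2 := F.reverse.card_far_two (W := W) hW'.1 (u := v) (by omega)
  rw [repMultiset_eq_iff.1 h, hd, hn, hn, hn, hn] at a2
  rw [hvv, hr _ le_rfl, hr _ (by omega), hr _ (by omega), hr _ (by omega), Nat.sub_self,
    Nat.sub_sub_self (by omega), Nat.sub_sub_self (by omega), Nat.sub_zero] at b2
  split_ifs at a2 b2 <;> omega

/-- A path of length two with a landmark at the first but not at the last vertex, and one landmark
among the leaves of each child of an end. -/
theorem isMResolving_of_two [Fintype V] (F : PathFrame G 2 P idx dep)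
    (hs : Separates G idx dep W)
    (h0 : ∃ w ∈ W, idx w = 0 ∧ dep w = 2) (h1 : ∃ w ∈ W, idx w = 2 ∧ dep w = 2)
    (hP0 : P 0 ∈ W) (hP2 : P 2 ∉ W)
    (hW : ∀ v, dep v = 1 → idx v ≠ 1 → (W ∩ leaves G dep v).card = 1) :
    IsMResolving G W := by
  refine F.isMResolving_of_opposite (by omega) hs h0 h1 fun u v hu hv hd h => ?_
  have hv' := F.idx_le v
  have hu0 : idx u = 0 := by omega
  have hv0 : idx v = 2 := by omega
  have kid : ∀ u v, dep u = 1 → dep v = 1 → idx u = 0 → idx v = 2 →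
      repMultiset G W u ≠ repMultiset G W v := by
    intro u v hu hv hu0 hv0 h
    have e1 := F.card_dist_one W hu
    have e2 := F.card_dist_one W hv
    rw [repMultiset_eq_iff.1 h, hu0, if_pos hP0, hW u hu (by omega)] at e1
    rw [hv0, if_neg hP2, hW v hv (by omega)] at e2
    omega
  have hd2 := F.dep_le u
  obtain h3 | h3 | h3 : dep u = 0 ∨ dep u = 1 ∨ dep u = 2 := by omega
  · have := mem_iff_of_repMultiset_eq F.tree.connected h
    rw [F.eq_P h3, F.eq_P (by omega : dep v = 0), hu0, hv0] at this
    exact hP2 (this.1 hP0)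
  · exact kid u v h3 (by omega) hu0 hv0 h
  · obtain ⟨x, hx, hx1, hxi⟩ := F.exists_parent h3
    obtain ⟨y, hy, hy1, hyi⟩ := F.exists_parent (by omega : dep v = 2)
    exact kid x y hx1 hy1 (by omega) (by omega) (F.repMultiset_kid_of_leaf hx1 hy1
      (mem_leaves.2 ⟨hx, h3⟩) (mem_leaves.2 ⟨hy, by omega⟩) h)

/-- A path of length zero: vertices at different depths of the same parity are the root and those at
depth `2`. -/
theorem isMResolving_of_zero [Fintype V] (F : PathFrame G 0 P idx dep)
    (hs : Separates G idx dep W)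
    (hW : (W.filter fun w => (idx w + dep w) % 2 = 0).card ≠
      (W.filter fun w => (idx w + dep w) % 2 = 1).card)
    (hleaf : ∀ u, dep u = 2 → repMultiset G W u ≠ repMultiset G W (P 0)) :
    IsMResolving G W := by
  intro u v hne h
  have hu := F.idx_le u
  have hv := F.idx_le v
  have hu2 := F.dep_le u
  have hv2 := F.dep_le v
  have hp := F.parity_eq_of_repMultiset_eq hW h
  by_cases hd : dep u = dep v
  · exact hne (F.eq_of_same_level hs (by omega) hd h)
  · obtain ⟨h1, h2⟩ | ⟨h1, h2⟩ : (dep u = 2 ∧ dep v = 0) ∨ (dep u = 0 ∧ dep v = 2) := by omega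
    · refine hleaf u h1 (h.trans ?_)
      rw [F.eq_P h2, show idx v = 0 by omega]
    · refine hleaf v h2 (h.symm.trans ?_)
      rw [F.eq_P h1, show idx u = 0 by omega]

end PathFrame

/-! ### Labelling the branches at a vertex -/

/-- A choice of labels for the branches at a path vertex. The first component of `φ v` prescribes
whether `v` is a landmark, the second one whether one of the `k v` leaves at `v` is a landmark. With
no leaf there is nothing to choose, and one of two leaves has to be chosen to tell them apart. -/
structure IsLabelling (K : Finset V) (k : V → ℕ) (φ : V → Bool × Bool) : Prop where
  inj : Set.InjOn φ K
  zero : ∀ v ∈ K, k v = 0 → (φ v).2 = false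
  two : ∀ v ∈ K, k v = 2 → (φ v).2 = true

/-- The number of prescribed landmarks at depth `1`. -/
noncomputable def fstCard (K : Finset V) (φ : V → Bool × Bool) : ℕ :=
  (K.filter fun v => (φ v).1 = true).card

/-- The number of prescribed landmarks at depth `2`. -/
noncomputable def sndCard (K : Finset V) (φ : V → Bool × Bool) : ℕ :=
  (K.filter fun v => (φ v).2 = true).card

lemma SmallBranches.exists_isLabelling {K : Finset V} {k : V → ℕ} (h : SmallBranches K k) :
    ∃ φ, IsLabelling K k φ := by
  let t : K → Finset (Bool × Bool) := fun v =>
    if k v = 0 then {(false, false), (true, false)}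
    else if k v = 2 then {(false, true), (true, true)} else Finset.univ
  have hall : ∀ s : Finset K, s.card ≤ (s.biUnion t).card := by
    intro s
    have hs4 : s.card ≤ 4 := (s.card_le_univ.trans (by simp)).trans h.1
    by_cases h1 : ∃ v ∈ s, k v ≠ 0 ∧ k v ≠ 2
    · obtain ⟨v, hv, h1, h2⟩ := h1
      have : (Finset.univ : Finset (Bool × Bool)) ⊆ s.biUnion t := by
        refine subset_trans ?_ (Finset.subset_biUnion_of_mem t hv)
        simp [t, h1, h2]
      exact hs4.trans (Finset.card_le_card this)
    · push Not at h1
      have hcard : ∀ j, (K.filter fun v => k v = j).card ≤ 2 → (∀ v ∈ s, k v = j) →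
          s.card ≤ 2 := by
        intro j hj hs
        refine le_trans (Finset.card_le_card_of_injOn Subtype.val ?_
          Subtype.val_injective.injOn) hj
        intro v hv
        simpa using hs v hv
      by_cases h0 : ∃ v ∈ s, k v = 0
      · obtain ⟨v, hv, hv0⟩ := h0
        have hsub := Finset.subset_biUnion_of_mem t hv
        by_cases h2 : ∃ w ∈ s, k w = 2
        · obtain ⟨w, hw, hw2⟩ := h2
          have hsub' := Finset.subset_biUnion_of_mem t hw
          have : (Finset.univ : Finset (Bool × Bool)) ⊆ s.biUnion t := by
            refine subset_trans ?_ (Finset.union_subset hsub hsub')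
            simp only [t, hv0, hw2, if_true, OfNat.ofNat_ne_zero, if_false]
            decide
          exact hs4.trans (Finset.card_le_card this)
        · push Not at h2
          refine (hcard 0 h.2.2.1 fun w hw => ?_).trans
            (le_trans (by simp [t, hv0]) (Finset.card_le_card hsub))
          by_contra hne
          exact h2 w hw (h1 w hw hne)
      · push Not at h0
        rcases s.eq_empty_or_nonempty with rfl | ⟨v, hv⟩
        · simp
        · refine (hcard 2 h.2.2.2 fun w hw => h1 w hw (h0 w hw)).trans
            (le_trans (by simp [t, h1 v hv (h0 v hv)])
              (Finset.card_le_card (Finset.subset_biUnion_of_mem t hv)))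
  obtain ⟨f, hf, hft⟩ := (Finset.all_card_le_biUnion_card_iff_exists_injective t).1 hall
  refine ⟨fun v => if hv : v ∈ K then f ⟨v, hv⟩ else (false, false), ?_, ?_, ?_⟩
  · intro v hv w hw hvw
    rw [Finset.mem_coe] at hv hw
    simp only [hv, hw, dif_pos] at hvw
    simpa using hf hvw
  · intro v hv h0
    have := hft ⟨v, hv⟩
    simp only [t, h0, if_true] at this
    simp only [hv, dif_pos]
    generalize f ⟨v, hv⟩ = x at this ⊢
    revert x
    decide
  · intro v hv h2
    have := hft ⟨v, hv⟩
    simp only [t, h2, if_true, OfNat.ofNat_ne_zero, if_false] at this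
    simp only [hv, dif_pos]
    generalize f ⟨v, hv⟩ = x at this ⊢
    revert x
    decide

/-- If some branch has a leaf then there is a labelling that makes some leaf a landmark: otherwise
no branch has two leaves, and one of the branches may be treated as if it had. -/
lemma SmallBranches.exists_isLabelling_pos {K : Finset V} {k : V → ℕ} (h : SmallBranches K k)
    (hk : ∃ v ∈ K, k v ≠ 0) : ∃ φ, IsLabelling K k φ ∧ 0 < sndCard K φ := by
  have pos : ∀ φ, ∀ v ∈ K, (φ v).2 = true → 0 < sndCard K φ := fun φ v hv h =>
    Finset.card_pos.2 ⟨v, Finset.mem_filter.2 ⟨hv, h⟩⟩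
  by_cases h2 : ∃ v ∈ K, k v = 2
  · obtain ⟨v, hv, hv2⟩ := h2
    obtain ⟨φ, hφ⟩ := h.exists_isLabelling
    exact ⟨φ, hφ, pos φ v hv (hφ.two v hv hv2)⟩
  · push Not at h2
    obtain ⟨v, hv, hv0⟩ := hk
    have hb : SmallBranches K (Function.update k v 2) := by
      refine ⟨h.1, ?_, ?_, ?_⟩
      · intro w hw
        by_cases hwv : w = v
        · simp [hwv]
        · simpa [hwv] using h.2.1 w hw
      · refine (Finset.card_le_card ?_).trans h.2.2.1
        intro w
        by_cases hwv : w = v <;> simp [hwv]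
      · refine (Finset.card_le_card (t := {v}) ?_).trans (by simp)
        intro w
        by_cases hwv : w = v
        · simp [hwv]
        · simpa [hwv] using h2 w
    obtain ⟨φ, hφ⟩ := hb.exists_isLabelling
    refine ⟨φ, ⟨hφ.inj, ?_, fun w hw hw2 => absurd hw2 (h2 w hw)⟩,
      pos φ v hv (hφ.two v hv (by simp))⟩
    intro w hw hw0
    refine hφ.zero w hw ?_
    rw [Function.update_of_ne (by rintro rfl; exact hv0 hw0), hw0]

lemma injOn_update {K : Finset V} {φ : V → Bool × Bool} (hφ : Set.InjOn φ K) {v : V}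
    {x : Bool × Bool} (hx : ∀ w ∈ K, w ≠ v → φ w ≠ x) :
    Set.InjOn (Function.update φ v x) K := by
  intro w hw w' hw' h
  by_cases h1 : w = v
  · by_cases h2 : w' = v
    · rw [h1, h2]
    · rw [h1, Function.update_self, Function.update_of_ne h2] at h
      exact absurd h.symm (hx w' hw' h2)
  · by_cases h2 : w' = v
    · rw [h2, Function.update_self, Function.update_of_ne h1] at h
      exact absurd h (hx w hw h1)
    · rw [Function.update_of_ne h1, Function.update_of_ne h2] at h
      exact hφ hw hw' h

lemma sndCard_congr {K : Finset V} {φ ψ : V → Bool × Bool} (h : ∀ v ∈ K, (φ v).2 = (ψ v).2) :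
    sndCard K φ = sndCard K ψ := by
  rw [sndCard, sndCard]
  congr 1
  exact Finset.filter_congr fun v hv => by rw [h v hv]

lemma fstCard_ne {K : Finset V} {φ ψ : V → Bool × Bool} {v : V} (hv : v ∈ K)
    (h : ∀ w ∈ K, w ≠ v → (φ w).1 = (ψ w).1) (hne : (φ v).1 ≠ (ψ v).1) :
    fstCard K φ ≠ fstCard K ψ := by
  have key : ∀ φ, fstCard K φ = (if (φ v).1 then 1 else 0) +
      ((K.erase v).filter fun w => (φ w).1 = true).card := by
    intro φ
    rw [fstCard, ← Finset.insert_erase hv, Finset.filter_insert]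
    split_ifs with hφ
    · rw [Finset.card_insert_of_notMem (by simp), Finset.insert_erase hv, add_comm]
    · simp
  rw [key, key]
  have : ((K.erase v).filter fun w => (φ w).1 = true) =
      (K.erase v).filter fun w => (ψ w).1 = true := by
    refine Finset.filter_congr fun w hw => ?_
    rw [Finset.mem_erase] at hw
    rw [h w hw.2 hw.1]
  rw [this]
  cases h1 : (φ v).1 <;> cases h2 : (ψ v).1 <;> simp_all

/-- At an end of the path, either two labellings prescribe equally many landmarks at depth `2` but
not at depth `1`, or these numbers are forced: there are four branches, which carry all the labels,
or two branches, both with two leaves. -/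
theorem SmallBranches.exists_pair_or_forced {K : Finset V} {k : V → ℕ} (h : SmallBranches K k)
    (hk : ∃ v ∈ K, k v ≠ 0) :
    (∃ φ ψ, IsLabelling K k φ ∧ IsLabelling K k ψ ∧ 0 < sndCard K φ ∧
      sndCard K φ = sndCard K ψ ∧ fstCard K φ ≠ fstCard K ψ) ∨
    ∃ φ, IsLabelling K k φ ∧ sndCard K φ = 2 ∧ ((K.card = 4 ∧ fstCard K φ = 2) ∨
      (K.card = 2 ∧ (∀ v ∈ K, k v = 2) ∧ fstCard K φ = 1)) := by
  obtain ⟨φ, hφ, hpos⟩ := h.exists_isLabelling_pos hk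
  have himg : (K.image φ).card = K.card := Finset.card_image_of_injOn hφ.inj
  have hcount : ∀ (q : Bool × Bool → Prop) [DecidablePred q],
      (K.filter fun v => q (φ v)).card = ((K.image φ).filter q).card := by
    intro q _
    rw [Finset.filter_image, Finset.card_image_of_injOn]
    exact hφ.inj.mono (Finset.coe_subset.2 (Finset.filter_subset _ _))
  by_cases h1 : ∃ v ∈ K, ∀ w ∈ K, φ w ≠ (!(φ v).1, (φ v).2)
  · -- The partner of the label of `v` is free, and `v` may take it.
    left
    obtain ⟨v, hv, hfree⟩ := h1
    have hsnd : ∀ w, (Function.update φ v (!(φ v).1, (φ v).2) w).2 = (φ w).2 := by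
      intro w
      by_cases hw : w = v <;> simp [hw]
    refine ⟨φ, Function.update φ v (!(φ v).1, (φ v).2), hφ,
      ⟨injOn_update hφ.inj fun w hw _ => hfree w hw, ?_, ?_⟩, hpos, ?_, ?_⟩
    · intro w hw hw0
      rw [hsnd, hφ.zero w hw hw0]
    · intro w hw hw2
      rw [hsnd, hφ.two w hw hw2]
    · exact sndCard_congr fun w _ => (hsnd w).symm
    · refine fstCard_ne hv (fun w _ hwv => by rw [Function.update_of_ne hwv]) (by simp)
  · -- The set of labels in use is closed under passing to the partner.
    push Not at h1
    have hcl : ∀ s t, (s, t) ∈ K.image φ → (!s, t) ∈ K.image φ := by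
      intro s t hst
      obtain ⟨v, hv, hvst⟩ := Finset.mem_image.1 hst
      obtain ⟨w, hw, hwv⟩ := h1 v hv
      rw [hvst] at hwv
      exact Finset.mem_image.2 ⟨w, hw, hwv⟩
    have htrue : (false, true) ∈ K.image φ ∧ (true, true) ∈ K.image φ := by
      obtain ⟨v, hv⟩ := Finset.card_pos.1 hpos
      rw [Finset.mem_filter] at hv
      have h2 : ((φ v).1, true) ∈ K.image φ :=
        Finset.mem_image.2 ⟨v, hv.1, by rw [← hv.2]⟩
      have h3 := hcl _ _ h2
      cases hs : (φ v).1 <;> rw [hs] at h2 h3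
      · exact ⟨h2, h3⟩
      · exact ⟨h3, h2⟩
    by_cases hfalse : (false, false) ∈ K.image φ
    · right
      have huniv : K.image φ = Finset.univ := by
        have h4 := hcl _ _ hfalse
        ext ⟨s, t⟩
        cases s <;> cases t <;> simp_all only [Bool.not_false, Finset.mem_univ]
      refine ⟨φ, hφ, ?_, Or.inl ⟨?_, ?_⟩⟩
      · rw [sndCard, hcount fun x => x.2 = true, huniv]
        decide
      · rw [← himg, huniv]
        decide
      · rw [fstCard, hcount fun x => x.1 = true, huniv]
        decide
    · have hpair : K.image φ = {(false, true), (true, true)} := by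
        have h4 : (true, false) ∉ K.image φ := fun h4 => hfalse (hcl _ _ h4)
        ext ⟨s, t⟩
        cases s <;> cases t <;> simp_all only [Finset.mem_insert, Finset.mem_singleton,
          Prod.mk.injEq, Bool.false_eq_true, Bool.true_eq_false, and_false, and_true, or_false,
          or_true, or_self, and_self]
      have hsnd : ∀ v ∈ K, (φ v).2 = true := by
        intro v hv
        have := Finset.mem_image_of_mem φ hv
        rw [hpair] at this
        generalize φ v = x at this ⊢
        revert x
        decide
      have hK : K.card = 2 := by rw [← himg, hpair]; decide
      by_cases h2 : ∀ v ∈ K, k v = 2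
      · right
        refine ⟨φ, hφ, ?_, Or.inr ⟨hK, h2, ?_⟩⟩
        · rw [sndCard, hcount fun x => x.2 = true, hpair]
          decide
        · rw [fstCard, hcount fun x => x.1 = true, hpair]
          decide
      · -- A branch with one leaf may get either of the labels with second component `false`.
        left
        push Not at h2
        obtain ⟨v, hv, hv2⟩ := h2
        have hv0 : k v ≠ 0 := by
          intro h0
          have := hφ.zero v hv h0
          rw [hsnd v hv] at this
          simp at this
        have hlab : ∀ s, IsLabelling K k (Function.update φ v (s, false)) := by
          intro s
          refine ⟨injOn_update hφ.inj fun w hw _ hw' => ?_, ?_, ?_⟩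
          · have := hsnd w hw
            rw [hw'] at this
            simp at this
          · intro w hw hw0
            by_cases hwv : w = v
            · simp [hwv]
            · rw [Function.update_of_ne hwv]
              exact hφ.zero w hw hw0
          · intro w hw hw2
            by_cases hwv : w = v
            · exact absurd (hwv ▸ hw2) hv2
            · rw [Function.update_of_ne hwv]
              exact hφ.two w hw hw2
        refine ⟨_, _, hlab false, hlab true, ?_, ?_, ?_⟩
        · obtain ⟨w, hw, hwv⟩ := Finset.exists_mem_ne (by omega : 1 < K.card) v
          refine Finset.card_pos.2 ⟨w, Finset.mem_filter.2 ⟨hw, ?_⟩⟩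
          rw [Function.update_of_ne hwv]
          exact hsnd w hw
        · refine sndCard_congr fun w _ => ?_
          by_cases hwv : w = v <;> simp [hwv]
        · refine fstCard_ne hv (fun w _ hwv => ?_) (by simp)
          rw [Function.update_of_ne hwv, Function.update_of_ne hwv]

/-- With at least two branches, the labels may be chosen such that no branch with a leaf carries
all the landmarks. -/
theorem SmallBranches.exists_isLabelling_spread {K : Finset V} {k : V → ℕ} (h : SmallBranches K k)
    (hK : 2 ≤ K.card) : ∃ φ, IsLabelling K k φ ∧
      ∀ v ∈ K, k v ≠ 0 → ∃ w ∈ K, w ≠ v ∧ φ w ≠ (false, false) := by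
  rcases hK.lt_or_eq with hlt | heq
  · obtain ⟨φ, hφ⟩ := h.exists_isLabelling
    refine ⟨φ, hφ, fun v hv _ => ?_⟩
    have h1 : 1 < (K.erase v).card := by
      rw [Finset.card_erase_of_mem hv]
      omega
    obtain ⟨x, hx, y, hy, hxy⟩ := Finset.one_lt_card.1 h1
    rw [Finset.mem_erase] at hx hy
    by_cases hx0 : φ x = (false, false)
    · refine ⟨y, hy.2, hy.1, fun hy0 => hxy (hφ.inj hx.2 hy.2 (hx0.trans hy0.symm))⟩
    · exact ⟨x, hx.2, hx.1, hx0⟩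
  · obtain ⟨x, y, hxy, rfl⟩ := Finset.card_eq_two.1 heq.symm
    have hx2 := h.2.1 x (by simp)
    have hy2 := h.2.1 y (by simp)
    refine ⟨fun v => if v = x then (true, decide (k x ≠ 0))
      else (decide (k y = 0 ∧ k x ≠ 0), decide (k y ≠ 0)), ⟨?_, ?_, ?_⟩, ?_⟩
    · intro v hv w hw hvw
      simp only [Finset.coe_insert, Finset.coe_singleton, Set.mem_insert_iff,
        Set.mem_singleton_iff] at hv hw
      rcases hv with rfl | rfl <;> rcases hw with rfl | rfl
      · rfl
      · simp [hxy.symm] at hvw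
        omega
      · simp [hxy.symm] at hvw
        omega
      · rfl
    · intro v hv hv0
      simp only [Finset.mem_insert, Finset.mem_singleton] at hv
      rcases hv with rfl | rfl
      · simp [hv0]
      · simp [hv0, hxy.symm]
    · intro v hv hv0
      simp only [Finset.mem_insert, Finset.mem_singleton] at hv
      rcases hv with rfl | rfl
      · simp [hv0]
      · simp [hv0, hxy.symm]
    · intro v hv hv0
      simp only [Finset.mem_insert, Finset.mem_singleton] at hv
      rcases hv with rfl | rfl
      · refine ⟨y, by simp, hxy.symm, ?_⟩
        simp only [hxy.symm, if_false, ne_eq, Prod.mk.injEq, decide_eq_false_iff_not]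
        tauto
      · exact ⟨x, by simp, hxy, by simp⟩

/-! ### Constructing m-resolving sets -/

namespace PathFrame

variable {ℓ : ℕ} {P : ℕ → V} {idx dep : V → ℕ}

lemma exists_mem_of_levelCard_pos {W : Finset V} {m d : ℕ} (h : 0 < levelCard idx dep W m d) :
    ∃ w ∈ W, idx w = m ∧ dep w = d := by
  obtain ⟨w, hw⟩ := Finset.card_pos.1 h
  rw [Finset.mem_filter] at hw
  exact ⟨w, hw⟩

section

variable [Fintype V]

/-- Labellings of the branches and an arbitrary set of path vertices are realized by a landmark
set. -/
theorem exists_separates (F : PathFrame G ℓ P idx dep) (a : ℕ → Bool) (Φ : ℕ → V → Bool × Bool)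
    (hΦ : ∀ i ≤ ℓ, IsLabelling (kids idx dep i) (fun v => (leaves G dep v).card) (Φ i))
    (hb : ∀ v, dep v = 1 → (leaves G dep v).card ≤ 2) :
    ∃ W, Separates G idx dep W ∧ (∀ i ≤ ℓ, P i ∈ W ↔ a i = true) ∧
      (∀ v, dep v = 1 → (v ∈ W ↔ (Φ (idx v) v).1 = true)) ∧
      (∀ v, dep v = 1 → (W ∩ leaves G dep v).card = if (Φ (idx v) v).2 then 1 else 0) ∧
      (∀ m ≤ ℓ, levelCard idx dep W m 0 = if a m then 1 else 0) ∧
      (∀ m, levelCard idx dep W m 1 = fstCard (kids idx dep m) (Φ m)) ∧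
      ∀ m ≤ ℓ, levelCard idx dep W m 2 = sndCard (kids idx dep m) (Φ m) := by
  have hk : ∀ v, dep v = 1 → v ∈ kids idx dep (idx v) := fun v hv => mem_kids.2 ⟨rfl, hv⟩
  have hlab : ∀ v, IsLabelling (kids idx dep (idx v)) (fun v => (leaves G dep v).card)
    (Φ (idx v)) := fun v => hΦ _ (F.idx_le v)
  -- the leaf of `v` that becomes a landmark if one has to
  have he : ∀ v, ∃ x, (leaves G dep v).Nonempty → x ∈ leaves G dep v := by
    intro v
    by_cases h : (leaves G dep v).Nonempty
    · exact ⟨h.choose, fun _ => h.choose_spec⟩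
    · exact ⟨v, fun h' => absurd h' h⟩
  choose e he using he
  have hne : ∀ v, dep v = 1 → (Φ (idx v) v).2 = true → e v ∈ leaves G dep v := by
    intro v hv ht
    refine he v (Finset.card_pos.1 (Nat.pos_of_ne_zero fun h0 => ?_))
    rw [(hlab v).zero v (hk v hv) h0] at ht
    simp at ht
  let W : Finset V := Finset.univ.filter fun w => (dep w = 0 ∧ a (idx w) = true) ∨
    (dep w = 1 ∧ (Φ (idx w) w).1 = true) ∨
    (dep w = 2 ∧ ∃ v, dep v = 1 ∧ (Φ (idx v) v).2 = true ∧ w = e v)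
  have hW0 : ∀ w, dep w = 0 → (w ∈ W ↔ a (idx w) = true) := by
    intro w hw
    simp [W, hw]
  have hW1 : ∀ w, dep w = 1 → (w ∈ W ↔ (Φ (idx w) w).1 = true) := by
    intro w hw
    simp [W, hw]
  have hW2 : ∀ w, dep w = 2 → (w ∈ W ↔ ∃ v, dep v = 1 ∧ (Φ (idx v) v).2 = true ∧ w = e v) := by
    intro w hw
    simp [W, hw]
  clear_value W
  have hWl : ∀ v, dep v = 1 → ∀ x ∈ leaves G dep v,
      (x ∈ W ↔ (Φ (idx v) v).2 = true ∧ x = e v) := by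
    intro v hv x hx
    rw [hW2 x (mem_leaves.1 hx).2]
    constructor
    · rintro ⟨v', hv', ht, rfl⟩
      have h1 := hne v' hv' ht
      have := F.parent_unique (mem_leaves.1 h1).2 hv hv' (mem_leaves.1 hx).1 (mem_leaves.1 h1).1
      subst this
      exact ⟨ht, rfl⟩
    · rintro ⟨ht, rfl⟩
      exact ⟨v, hv, ht, rfl⟩
  have hcard : ∀ v, dep v = 1 → (W ∩ leaves G dep v).card =
      if (Φ (idx v) v).2 then 1 else 0 := by
    intro v hv
    split_ifs with ht
    · rw [Finset.card_eq_one]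
      refine ⟨e v, ?_⟩
      ext x
      rw [Finset.mem_inter, Finset.mem_singleton]
      constructor
      · rintro ⟨h1, h2⟩
        exact ((hWl v hv x h2).1 h1).2
      · rintro rfl
        exact ⟨(hWl v hv _ (hne v hv ht)).2 ⟨ht, rfl⟩, hne v hv ht⟩
    · rw [Finset.card_eq_zero, Finset.eq_empty_iff_forall_notMem]
      intro x hx
      rw [Finset.mem_inter] at hx
      exact ht ((hWl v hv x hx.2).1 hx.1).1
  have hP : ∀ i ≤ ℓ, P i ∈ W ↔ a i = true := by
    intro i hi
    rw [hW0 _ (F.dep_P hi), F.idx_P i hi]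
  refine ⟨W, ⟨?_, ?_⟩, hP, hW1, hcard, ?_, ?_, ?_⟩
  · intro v hv x hx y hy hxy
    rw [hWl v hv x hx, hWl v hv y hy] at hxy
    by_contra hne'
    cases ht : (Φ (idx v) v).2 with
    | false =>
      have h2 : (leaves G dep v).card ≠ 2 := fun h2 => by
        rw [(hlab v).two v (hk v hv) h2] at ht
        simp at ht
      have h3 := hb v hv
      exact hne' (Finset.card_le_one.1 (by omega) x hx y hy)
    | true =>
      rw [ht] at hxy
      simp only [true_and] at hxy
      have hxe : x ≠ e v := fun h => hne' (h.trans (hxy.1 h).symm)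
      have hye : y ≠ e v := fun h => hxe (hxy.2 h)
      have h3 : ({x, y, e v} : Finset V) ⊆ leaves G dep v := by
        intro z hz
        simp only [Finset.mem_insert, Finset.mem_singleton] at hz
        rcases hz with rfl | rfl | rfl
        · exact hx
        · exact hy
        · exact hne v hv ht
      have h4 := Finset.card_le_card h3
      rw [Finset.card_eq_three.2 ⟨x, y, e v, hne', hxe, hye, rfl⟩] at h4
      have := hb v hv
      omega
  · intro v v' hv hv' hi hmem hc
    have h1 := hk v' hv'
    rw [← hi] at h1
    refine (hlab v).inj (hk v hv) h1 (Prod.ext ?_ ?_)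
    · rw [hW1 v hv, hW1 v' hv', ← hi, ← Bool.eq_iff_iff] at hmem
      exact hmem
    · rw [hcard v hv, hcard v' hv', ← hi] at hc
      cases h2 : (Φ (idx v) v).2 <;> cases h3 : (Φ (idx v) v').2 <;> simp_all
  · intro m hm
    have : (W.filter fun w => idx w = m ∧ dep w = 0) = if a m then {P m} else ∅ := by
      ext w
      rw [Finset.mem_filter]
      constructor
      · rintro ⟨h1, rfl, h3⟩
        rw [if_pos ((hW0 w h3).1 h1), Finset.mem_singleton]
        exact F.eq_P h3
      · split_ifs with h
        · rw [Finset.mem_singleton]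
          rintro rfl
          exact ⟨(hP m hm).2 h, F.idx_P m hm, F.dep_P hm⟩
        · simp
    rw [levelCard, this]
    split <;> simp
  · intro m
    rw [levelCard, fstCard]
    congr 1
    ext w
    rw [Finset.mem_filter, Finset.mem_filter, mem_kids]
    constructor
    · rintro ⟨h1, rfl, h3⟩
      exact ⟨⟨rfl, h3⟩, (hW1 w h3).1 h1⟩
    · rintro ⟨⟨rfl, h3⟩, h1⟩
      exact ⟨(hW1 w h3).2 h1, rfl, h3⟩
  · intro m hm
    rw [levelCard, sndCard]
    symm
    refine Finset.card_bij (fun v _ => e v) ?_ ?_ ?_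
    · intro v hv
      rw [Finset.mem_filter, mem_kids] at hv
      obtain ⟨⟨rfl, hv⟩, ht⟩ := hv
      have h1 := hne v hv ht
      rw [Finset.mem_filter]
      exact ⟨(hWl v hv _ h1).2 ⟨ht, rfl⟩, F.idx_of_mem_leaves hv h1, (mem_leaves.1 h1).2⟩
    · intro v hv v' hv' h
      rw [Finset.mem_filter, mem_kids] at hv hv'
      obtain ⟨⟨rfl, hv⟩, ht⟩ := hv
      obtain ⟨⟨hi, hv'⟩, ht'⟩ := hv'
      rw [← hi] at ht'
      have h1 := mem_leaves.1 (hne v hv ht)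
      have h2 := mem_leaves.1 (hne v' hv' ht')
      rw [← h] at h2
      exact F.parent_unique h1.2 hv hv' h1.1 h2.1
    · intro x hx
      rw [Finset.mem_filter] at hx
      obtain ⟨v, hv, ht, rfl⟩ := (hW2 x hx.2.2).1 hx.1
      have := F.idx_of_mem_leaves hv (hne v hv ht)
      rw [hx.2.1] at this
      subst this
      exact ⟨v, Finset.mem_filter.2 ⟨mem_kids.2 ⟨rfl, hv⟩, ht⟩, rfl⟩

/-- Adding one path vertex to a landmark set changes the parity balance and nothing else. -/
lemma exists_parity_ne (F : PathFrame G ℓ P idx dep) {W : Finset V} (hs : Separates G idx dep W)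
    {i : ℕ} (hi : i ≤ ℓ) (hP : P i ∉ W) : ∃ W', Separates G idx dep W' ∧ W ⊆ W' ∧
      (W'.filter fun w => (idx w + dep w) % 2 = 0).card ≠
      (W'.filter fun w => (idx w + dep w) % 2 = 1).card := by
  by_cases h : (W.filter fun w => (idx w + dep w) % 2 = 0).card ≠
      (W.filter fun w => (idx w + dep w) % 2 = 1).card
  · exact ⟨W, hs, subset_rfl, h⟩
  · refine ⟨insert (P i) W, ?_, Finset.subset_insert _ _, ?_⟩
    · have hmem : ∀ w, dep w ≠ 0 → (w ∈ insert (P i) W ↔ w ∈ W) := by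
        intro w hw
        rw [Finset.mem_insert, or_iff_right]
        rintro rfl
        exact hw (F.dep_P hi)
      have hint : ∀ v, insert (P i) W ∩ leaves G dep v = W ∩ leaves G dep v := by
        intro v
        refine Finset.insert_inter_of_notMem fun h => ?_
        rw [mem_leaves, F.dep_P hi] at h
        omega
      refine ⟨?_, ?_⟩
      · intro v hv x hx y hy hxy
        have hx2 := (mem_leaves.1 hx).2
        have hy2 := (mem_leaves.1 hy).2
        rw [hmem x (by omega), hmem y (by omega)] at hxy
        exact hs.leaf v hv x hx y hy hxy
      · intro v v' hv hv' hvi hm hc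
        rw [hmem v (by omega), hmem v' (by omega)] at hm
        rw [hint, hint] at hc
        exact hs.kid v v' hv hv' hvi hm hc
    · rw [Finset.filter_insert, Finset.filter_insert]
      rcases Nat.mod_two_eq_zero_or_one (idx (P i) + dep (P i)) with h1 | h1 <;>
      simp only [h1, zero_ne_one, one_ne_zero, if_true, if_false] <;>
      rw [Finset.card_insert_of_notMem (by simp [hP])] <;> omega

lemma exists_kid_of_depth_two (F : PathFrame G ℓ P idx dep) {i : ℕ}
    (h : ∃ w, idx w = i ∧ dep w = 2) : ∃ v ∈ kids idx dep i, (leaves G dep v).card ≠ 0 := by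
  obtain ⟨w, rfl, hw⟩ := h
  obtain ⟨v, hv, hv1, hvi⟩ := F.exists_parent hw
  exact ⟨v, mem_kids.2 ⟨hvi, hv1⟩, Finset.card_ne_zero_of_mem (mem_leaves.2 ⟨hv, hw⟩)⟩

lemma card_leaves_le (F : PathFrame G ℓ P idx dep)
    (hb : ∀ i ≤ ℓ, SmallBranches (kids idx dep i) fun v => (leaves G dep v).card)
    (v : V) (hv : dep v = 1) : (leaves G dep v).card ≤ 2 :=
  (hb _ (F.idx_le v)).2.1 v (mem_kids.2 ⟨rfl, hv⟩)

/-- Parity alone settles paths of odd length, whatever the labellings: the last path vertex is made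
a landmark if the two colours are balanced otherwise. -/
theorem exists_isMResolving_of_odd (F : PathFrame G ℓ P idx dep) (hℓ : ℓ % 2 = 1)
    (hb : ∀ i ≤ ℓ, SmallBranches (kids idx dep i) fun v => (leaves G dep v).card)
    (h0 : ∃ w, idx w = 0 ∧ dep w = 2) (h1 : ∃ w, idx w = ℓ ∧ dep w = 2) :
    ∃ W, IsMResolving G W := by
  have hex : ∀ i, ∃ φ, i ≤ ℓ → IsLabelling (kids idx dep i) (fun v => (leaves G dep v).card) φ ∧
      ((i = 0 ∨ i = ℓ) → 0 < sndCard (kids idx dep i) φ) := by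
    intro i
    by_cases hi : i ≤ ℓ
    · by_cases hi' : i = 0 ∨ i = ℓ
      · obtain ⟨φ, h1, h2⟩ := (hb i hi).exists_isLabelling_pos (F.exists_kid_of_depth_two
          (by rcases hi' with rfl | rfl <;> assumption))
        exact ⟨φ, fun _ => ⟨h1, fun _ => h2⟩⟩
      · obtain ⟨φ, h1⟩ := (hb i hi).exists_isLabelling
        exact ⟨φ, fun _ => ⟨h1, fun h => absurd h hi'⟩⟩
    · exact ⟨fun _ => (false, false), fun h => absurd h hi⟩
  choose Φ hΦ using hex
  obtain ⟨W, hs, hP, -, -, -, -, hW2⟩ := F.exists_separates (fun _ => false) Φ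
    (fun i hi => (hΦ i hi).1) (F.card_leaves_le hb)
  obtain ⟨W', hs', hsub, hpar⟩ := F.exists_parity_ne hs le_rfl
    (by simpa using (hP ℓ le_rfl).not.2 (by simp))
  have h3 : ∀ m ≤ ℓ, (m = 0 ∨ m = ℓ) → ∃ w ∈ W', idx w = m ∧ dep w = 2 := by
    intro m hm hm'
    obtain ⟨w, hw, h⟩ := exists_mem_of_levelCard_pos (W := W) (m := m) (d := 2)
      (by rw [hW2 m hm]; exact (hΦ m hm).2 hm')
    exact ⟨w, hsub hw, h⟩
  exact ⟨W', F.isMResolving_of_odd hℓ hs' (h3 0 (by omega) (by simp)) (h3 ℓ le_rfl (by simp)) hpar⟩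

/-- Choosing which ends of the path are landmarks shifts the difference `x - y` by any of `-1`, `0`,
`1`. One of these three consecutive values is not among `-2`, `0`, `2`. -/
lemma exists_bool_shift (x y : ℕ) : ∃ s t : Bool,
    (if s then 1 else 0) + x ≠ (if t then 1 else 0) + y ∧
    (if s then 1 else 0) + x ≠ (if t then 1 else 0) + y + 2 ∧
    (if s then 1 else 0) + x + 2 ≠ (if t then 1 else 0) + y := by
  by_cases h : x = y ∨ x = y + 2 ∨ x + 2 = y
  · by_cases h' : x + 2 = y
    · exact ⟨true, false, by simp; omega⟩
    · by_cases h'' : x = y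
      · exact ⟨true, false, by simp; omega⟩
      · exact ⟨false, true, by simp; omega⟩
  · exact ⟨false, false, by simp; omega⟩

/-- For a path of even length the labellings at the ends are used to tell the two sides apart. If
they are forced at both ends, the two ends of the path itself remain to be chosen; this fails only
if the path has length two and there are four branches at each end. -/
theorem exists_isMResolving_of_even (F : PathFrame G ℓ P idx dep) (hℓ : 0 < ℓ)
    (heven : ℓ % 2 = 0)
    (hb : ∀ i ≤ ℓ, SmallBranches (kids idx dep i) fun v => (leaves G dep v).card)
    (h0 : ∃ w, idx w = 0 ∧ dep w = 2) (h1 : ∃ w, idx w = ℓ ∧ dep w = 2)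
    (hex : ¬ (ℓ = 2 ∧ (kids idx dep 0).card = 4 ∧ (kids idx dep ℓ).card = 4)) :
    ∃ W, IsMResolving G W := by
  let L (i : ℕ) (φ : V → Bool × Bool) : Prop :=
    IsLabelling (kids idx dep i) (fun v => (leaves G dep v).card) φ
  have hin : ∀ i, ∃ φ, i ≤ ℓ → L i φ := by
    intro i
    by_cases hi : i ≤ ℓ
    · obtain ⟨φ, h⟩ := (hb i hi).exists_isLabelling
      exact ⟨φ, fun _ => h⟩
    · exact ⟨fun _ => (false, false), fun h => absurd h hi⟩
  choose Φ hΦ using hin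
  -- landmark sets with given labellings at the ends, and the labelling `Φ` elsewhere
  have real : ∀ φ ψ (a : ℕ → Bool), L 0 φ → L ℓ ψ → 0 < sndCard (kids idx dep 0) φ →
      0 < sndCard (kids idx dep ℓ) ψ → ∃ W, Separates G idx dep W ∧
        (∃ w ∈ W, idx w = 0 ∧ dep w = 2) ∧ (∃ w ∈ W, idx w = ℓ ∧ dep w = 2) ∧
        (∀ i ≤ ℓ, P i ∈ W ↔ a i = true) ∧
        (∀ v, dep v = 1 → idx v = 0 → (W ∩ leaves G dep v).card = if (φ v).2 then 1 else 0) ∧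
        (∀ v, dep v = 1 → idx v = ℓ → (W ∩ leaves G dep v).card = if (ψ v).2 then 1 else 0) ∧
        ((sndCard (kids idx dep ℓ) ψ = sndCard (kids idx dep 0) φ →
          fstCard (kids idx dep ℓ) ψ + sndCard (kids idx dep (ℓ - 1)) (Φ (ℓ - 1)) =
            fstCard (kids idx dep 0) φ + sndCard (kids idx dep 1) (Φ 1) → 4 ≤ ℓ ∧
          (if a ℓ then 1 else 0) + fstCard (kids idx dep (ℓ - 1)) (Φ (ℓ - 1)) +
              sndCard (kids idx dep (ℓ - 2)) (Φ (ℓ - 2)) ≠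
            (if a 0 then 1 else 0) + fstCard (kids idx dep 1) (Φ 1) +
              sndCard (kids idx dep 2) (Φ 2) ∧
          (if a ℓ then 1 else 0) + fstCard (kids idx dep (ℓ - 1)) (Φ (ℓ - 1)) +
              sndCard (kids idx dep (ℓ - 2)) (Φ (ℓ - 2)) ≠
            (if a 0 then 1 else 0) + fstCard (kids idx dep 1) (Φ 1) +
              sndCard (kids idx dep 2) (Φ 2) + sndCard (kids idx dep 0) φ ∧
          (if a ℓ then 1 else 0) + fstCard (kids idx dep (ℓ - 1)) (Φ (ℓ - 1)) +
              sndCard (kids idx dep (ℓ - 2)) (Φ (ℓ - 2)) + sndCard (kids idx dep 0) φ ≠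
            (if a 0 then 1 else 0) + fstCard (kids idx dep 1) (Φ 1) +
              sndCard (kids idx dep 2) (Φ 2)) → IsMResolving G W) := by
    intro φ ψ a hφ hψ hφ0 hψ0
    let Ψ : ℕ → V → Bool × Bool := fun i => if i = 0 then φ else if i = ℓ then ψ else Φ i
    have hΨ0 : Ψ 0 = φ := rfl
    have hΨℓ : Ψ ℓ = ψ := by
      simp only [Ψ, if_neg hℓ.ne', if_true]
    have hΨ : ∀ i, 0 < i → i < ℓ → Ψ i = Φ i := by
      intro i h1 h2
      simp only [Ψ, if_neg h1.ne', if_neg h2.ne]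
    obtain ⟨W, hs, hP, -, hc, hW0, hW1, hW2⟩ := F.exists_separates a Ψ (by
      intro i hi
      by_cases h1 : i = 0
      · rw [h1, hΨ0]
        exact hφ
      · by_cases h2 : i = ℓ
        · rw [h2, hΨℓ]
          exact hψ
        · rw [hΨ i (by omega) (by omega)]
          exact hΦ i hi) (F.card_leaves_le hb)
    have e0 : ∃ w ∈ W, idx w = 0 ∧ dep w = 2 :=
      exists_mem_of_levelCard_pos (by rw [hW2 0 hℓ.le, hΨ0]; exact hφ0)
    have e1 : ∃ w ∈ W, idx w = ℓ ∧ dep w = 2 :=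
      exists_mem_of_levelCard_pos (by rw [hW2 ℓ le_rfl, hΨℓ]; exact hψ0)
    refine ⟨W, hs, e0, e1, hP, ?_, ?_, ?_⟩
    · intro v hv hi
      rw [hc v hv, hi, hΨ0]
    · intro v hv hi
      rw [hc v hv, hi, hΨℓ]
    · intro h
      refine F.isMResolving_of_even hℓ heven hs e0 e1 _ (fun _ _ => rfl) ?_
      rw [hW2 ℓ le_rfl, hW2 0 hℓ.le, hW1 ℓ, hW1 0, hW2 (ℓ - 1) (by omega), hW2 1 (by omega),
        hΨ (ℓ - 1) (by omega) (by omega), hΨ 1 (by omega) (by omega), hΨ0, hΨℓ]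
      intro h1 h2
      have h3 := h h1 h2
      rw [hW0 ℓ le_rfl, hW0 0 hℓ.le, hW1, hW1, hW2 _ (by omega), hW2 _ (by omega),
        hΨ (ℓ - 1) (by omega) (by omega), hΨ 1 (by omega) (by omega),
        hΨ (ℓ - 2) (by omega) (by omega), hΨ 2 (by omega) (by omega)]
      exact h3
  rcases (hb 0 hℓ.le).exists_pair_or_forced (F.exists_kid_of_depth_two h0) with
    ⟨φ, φ', hφ, hφ', hpos, hsnd, hfst⟩ | ⟨φ, hφ, hφ2, hφc⟩
  · -- One of the two labellings at the first end makes the numbers of landmarks at the second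
    -- largest distance differ.
    obtain ⟨ψ, hψ, hψ0⟩ := (hb ℓ le_rfl).exists_isLabelling_pos (F.exists_kid_of_depth_two h1)
    by_cases hne : fstCard (kids idx dep ℓ) ψ + sndCard (kids idx dep (ℓ - 1)) (Φ (ℓ - 1)) =
            fstCard (kids idx dep 0) φ + sndCard (kids idx dep 1) (Φ 1)
    · obtain ⟨W, -, -, -, -, -, -, hW⟩ := real φ' ψ (fun _ => false) hφ' hψ (hsnd ▸ hpos) hψ0
      exact ⟨W, hW fun _ h => by omega⟩
    · obtain ⟨W, -, -, -, -, -, -, hW⟩ := real φ ψ (fun _ => false) hφ hψ hpos hψ0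
      exact ⟨W, hW fun _ h => absurd h hne⟩
  rcases (hb ℓ le_rfl).exists_pair_or_forced (F.exists_kid_of_depth_two h1) with
    ⟨ψ, ψ', hψ, hψ', hpos, hsnd, hfst⟩ | ⟨ψ, hψ, hψ2, hψc⟩
  · by_cases hne : fstCard (kids idx dep ℓ) ψ + sndCard (kids idx dep (ℓ - 1)) (Φ (ℓ - 1)) =
            fstCard (kids idx dep 0) φ + sndCard (kids idx dep 1) (Φ 1)
    · obtain ⟨W, -, -, -, -, -, -, hW⟩ := real φ ψ' (fun _ => false) hφ hψ' (by omega) (by omega)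
      exact ⟨W, hW fun _ h => by omega⟩
    · obtain ⟨W, -, -, -, -, -, -, hW⟩ := real φ ψ (fun _ => false) hφ hψ (by omega) hpos
      exact ⟨W, hW fun _ h => absurd h hne⟩
  by_cases h4 : 4 ≤ ℓ
  · obtain ⟨s, t, hst⟩ := exists_bool_shift
      (fstCard (kids idx dep (ℓ - 1)) (Φ (ℓ - 1)) + sndCard (kids idx dep (ℓ - 2)) (Φ (ℓ - 2)))
      (fstCard (kids idx dep 1) (Φ 1) + sndCard (kids idx dep 2) (Φ 2))
    obtain ⟨W, -, -, -, -, -, -, hW⟩ := real φ ψ (fun i => if i = 0 then t else s) hφ hψ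
      (by omega) (by omega)
    refine ⟨W, hW fun _ _ => ⟨h4, ?_⟩⟩
    simp only [if_neg hℓ.ne', if_true, hφ2]
    omega
  · obtain rfl : ℓ = 2 := by omega
    obtain ⟨W, hs, e0, e1, hP, hc0, hc1, hW⟩ := real φ ψ (fun i => decide (i = 0)) hφ hψ
      (by omega) (by omega)
    by_cases hne : fstCard (kids idx dep 2) ψ = fstCard (kids idx dep 0) φ
    · have h20 : (∀ v ∈ kids idx dep 0, (leaves G dep v).card = 2) ∧
          ∀ v ∈ kids idx dep 2, (leaves G dep v).card = 2 := by
        rcases hφc with hφc | hφc <;> rcases hψc with hψc | hψc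
        · exact absurd ⟨rfl, hφc.1, hψc.1⟩ hex
        · omega
        · omega
        · exact ⟨hφc.2.1, hψc.2.1⟩
      refine ⟨W, F.isMResolving_of_two hs e0 e1 ((hP 0 (by omega)).2 (by simp))
        ((hP 2 le_rfl).not.2 (by simp)) ?_⟩
      intro v hv hi
      have hi2 := F.idx_le v
      obtain hi0 | hi0 : idx v = 0 ∨ idx v = 2 := by omega
      · have hk : v ∈ kids idx dep 0 := mem_kids.2 ⟨hi0, hv⟩
        rw [hc0 v hv hi0, hφ.two v hk (h20.1 v hk), if_pos rfl]
      · have hk : v ∈ kids idx dep 2 := mem_kids.2 ⟨hi0, hv⟩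
        rw [hc1 v hv hi0, hψ.two v hk (h20.2 v hk), if_pos rfl]
    · exact ⟨W, hW fun _ h => absurd (by simpa using h) hne⟩

/-- A tree of height at most two from its root. The excluded case of a single branch with two leaves
is that of an `S_4` rooted at a leaf. -/
theorem exists_isMResolving_of_zero (F : PathFrame G 0 P idx dep)
    (hb : SmallBranches (kids idx dep 0) fun v => (leaves G dep v).card)
    (hex : ¬ ∃ v, kids idx dep 0 = {v} ∧ (leaves G dep v).card = 2) :
    ∃ W, IsMResolving G W := by
  have hidx : ∀ v, idx v = 0 := fun v => Nat.le_zero.1 (F.idx_le v)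
  have hb' := F.card_leaves_le (fun i hi => by rwa [Nat.le_zero.1 hi])
  by_cases hK : 2 ≤ (kids idx dep 0).card
  · -- A landmark in another branch is at distance at least `3` from `u`.
    obtain ⟨φ, hφ, hspread⟩ := hb.exists_isLabelling_spread hK
    obtain ⟨W, hs, hP, hm, hc, -, -, -⟩ := F.exists_separates (fun _ => false) (fun _ => φ)
      (fun i hi => by rwa [Nat.le_zero.1 hi]) hb'
    obtain ⟨W', hs', hsub, hpar⟩ := F.exists_parity_ne hs le_rfl
      (by simpa using (hP 0 le_rfl).not.2 (by simp))
    refine ⟨W', F.isMResolving_of_zero hs' hpar fun u hu h => ?_⟩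
    obtain ⟨v, hv, hv1, -⟩ := F.exists_parent hu
    have hul := mem_leaves.2 ⟨hv, hu⟩
    obtain ⟨w, hw, hwv, hw0⟩ := hspread v (mem_kids.2 ⟨hidx v, hv1⟩)
      (Finset.card_ne_zero_of_mem hul)
    have hw1 := (mem_kids.1 hw).2
    have key : ∃ x ∈ W', x = w ∨ (G.Adj w x ∧ dep x = 2) := by
      by_cases h1 : (φ w).1 = true
      · exact ⟨w, hsub ((hm w hw1).2 h1), Or.inl rfl⟩
      · have h2 : (φ w).2 = true := by
          by_contra h2
          exact hw0 (Prod.ext (by simpa using h1) (by simpa using h2))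
        have h3 := hc w hw1
        rw [if_pos h2] at h3
        obtain ⟨x, hx⟩ := Finset.card_pos.1 (h3 ▸ Nat.one_pos)
        rw [Finset.mem_inter, mem_leaves] at hx
        exact ⟨x, hsub hx.1, Or.inr hx.2⟩
    obtain ⟨x, hx, hxw⟩ := key
    obtain ⟨y, hy, hyd⟩ := exists_dist_eq h hx
    have hxd : dep x = 1 ∨ dep x = 2 := by
      rcases hxw with rfl | hxw
      · exact Or.inl hw1
      · exact Or.inr hxw.2
    have hxu : x ≠ u := by
      rintro rfl
      rcases hxw with rfl | hxw
      · omega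
      · exact hwv (F.parent_unique hu hw1 hv1 hxw.1 hv)
    have hnb : ¬ (x = v ∨ (G.Adj v x ∧ dep x = 2)) := by
      rintro (rfl | hxv)
      · rcases hxw with rfl | hxw
        · exact hwv rfl
        · omega
      · rcases hxw with rfl | hxw
        · omega
        · exact hwv (F.parent_unique hxw.2 hw1 hv1 hxw.1 hxv.1)
    have e1 := F.dist_of_leaf hu hv1 hv hxu
    have e2 : G.dist v x = G.dist (P (idx v)) x + 1 := by
      rcases F.dist_of_branch (w := x) hv1 with h | h
      · exact absurd h.1 hnb
      · exact h.2
    have e3 := F.dist_root x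
    have e4 := F.dist_root y
    have e5 := F.dep_le y
    rw [hidx] at e2 e3 e4
    omega
  · -- With a single branch the root serves as the only landmark.
    refine ⟨{P 0}, F.isMResolving_of_zero ⟨?_, ?_⟩ ?_ ?_⟩
    · intro v hv x hx y hy _
      refine Finset.card_le_one.1 ?_ x hx y hy
      have h1 := hb' v hv
      have h2 : (leaves G dep v).card ≠ 2 := fun h2 => hex ⟨v, by
        have hvk : v ∈ kids idx dep 0 := mem_kids.2 ⟨hidx v, hv⟩
        refine (Finset.eq_singleton_iff_unique_mem.2 ⟨hvk, fun w hw =>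
          Finset.card_le_one.1 (by omega) w hw v hvk⟩), h2⟩
      omega
    · intro v v' hv hv' _ _ _
      exact Finset.card_le_one.1 (by omega : (kids idx dep 0).card ≤ 1) v
        (mem_kids.2 ⟨hidx v, hv⟩) v' (mem_kids.2 ⟨hidx v', hv'⟩)
    · rw [Finset.filter_singleton, Finset.filter_singleton, F.idx_P 0 le_rfl, F.dep_P le_rfl]
      simp
    · intro u hu h
      have h1 := (mem_iff_of_repMultiset_eq F.tree.connected h).2 (by simp)
      rw [Finset.mem_singleton] at h1
      rw [h1, F.dep_P le_rfl] at hu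
      omega

end

end PathFrame

/-! ### Stars -/

lemma nonempty_starGraph_iso {α β : Type*} [Finite α] [Finite β] (c : α) (d : β)
    (h : Nat.card α = Nat.card β) : Nonempty (starGraph c ≃g starGraph d) := by
  obtain ⟨e⟩ := Finite.card_eq.1 h
  obtain ⟨f, rfl⟩ : ∃ f : α ≃ β, f c = d := ⟨e.trans (Equiv.swap (e c) d), by simp⟩
  refine ⟨⟨f, ?_⟩⟩
  intro x y
  simp only [starGraph_adj, ne_eq, EmbeddingLike.apply_eq_iff_eq]

lemma pathGraph_two_eq_starGraph : pathGraph 2 = starGraph 0 := by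
  ext x y
  rw [pathGraph_adj, starGraph_adj]
  fin_cases x <;> fin_cases y <;> simp

lemma pathGraph_three_eq_starGraph : pathGraph 3 = starGraph 1 := by
  ext x y
  rw [pathGraph_adj, starGraph_adj]
  fin_cases x <;> fin_cases y <;> simp

lemma completeBipartiteGraph_eq_starGraph :
    completeBipartiteGraph (Fin 1) (Fin 3) = starGraph (Sum.inl 0) := by
  ext x y
  rw [completeBipartiteGraph_adj, starGraph_adj]
  rcases x with x | x <;> rcases y with y | y <;> simp [Subsingleton.elim _ (0 : Fin 1)]

section Star

variable {α : Type*} [Finite α] (c : α)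

lemma isPathOn_two_starGraph_iff : IsPathOn 2 (starGraph c) ↔ Nat.card α = 2 := by
  constructor
  · rintro ⟨e⟩
    simpa using Nat.card_congr e.toEquiv
  · intro h
    rw [IsPathOn, pathGraph_two_eq_starGraph]
    exact nonempty_starGraph_iso _ _ (by simpa using h)

lemma isPathOn_three_starGraph_iff : IsPathOn 3 (starGraph c) ↔ Nat.card α = 3 := by
  constructor
  · rintro ⟨e⟩
    simpa using Nat.card_congr e.toEquiv
  · intro h
    rw [IsPathOn, pathGraph_three_eq_starGraph]
    exact nonempty_starGraph_iso _ _ (by simpa using h)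

lemma isS4_starGraph_iff : IsS4 (starGraph c) ↔ Nat.card α = 4 := by
  constructor
  · rintro ⟨e⟩
    simpa using Nat.card_congr e.toEquiv
  · intro h
    rw [IsS4, completeBipartiteGraph_eq_starGraph]
    exact nonempty_starGraph_iso _ _ (by simpa using h)

end Star

/-! ### The separation of a tree of height two -/

namespace PathFrame

variable {ℓ : ℕ} {P : ℕ → V} {idx dep : V → ℕ}

lemma dep_eq_zero_iff (F : PathFrame G 0 P idx dep) {w : V} : dep w = 0 ↔ w = P 0 := by
  constructor
  · intro h
    have h1 := F.eq_P h
    rwa [Nat.le_zero.1 (F.idx_le w)] at h1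
  · rintro rfl
    exact F.dep_P le_rfl

lemma adj_root_iff (F : PathFrame G 0 P idx dep) {w : V} : G.Adj (P 0) w ↔ dep w = 1 := by
  have h := F.dist_root w
  rw [Nat.le_zero.1 (F.idx_le w)] at h
  rw [← dist_eq_one_iff_adj, h]

/-- The branch of a vertex `w` off the path: the child below which `w` lies. -/
lemma exists_branch [Fintype V] (F : PathFrame G ℓ P idx dep) : ∃ top : V → V,
    (∀ w, dep w = 1 → top w = w) ∧
    (∀ w, dep w = 2 → dep (top w) = 1 ∧ G.Adj (top w) w) ∧
    (∀ v w, dep v = 1 → w ∈ leaves G dep v → top w = v) ∧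
    ∀ v w, dep v ≠ 0 → dep w ≠ 0 → G.Adj v w → top v = top w := by
  have h : ∀ w, ∃ v, (dep w = 1 → v = w) ∧ (dep w = 2 → dep v = 1 ∧ G.Adj v w) := by
    intro w
    by_cases h2 : dep w = 2
    · obtain ⟨v, hv, hv1, -⟩ := F.exists_parent h2
      exact ⟨v, fun h => by omega, fun _ => ⟨hv1, hv⟩⟩
    · exact ⟨w, fun _ => rfl, fun h => absurd h h2⟩
  choose top h1 h2 using h
  have h3 : ∀ v w, dep v = 1 → w ∈ leaves G dep v → top w = v := by
    intro v w hv hw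
    rw [mem_leaves] at hw
    have := h2 w hw.2
    exact F.parent_unique hw.2 this.1 hv this.2 hw.1
  have h4 : ∀ v w, dep v = 1 → dep w ≠ 0 → G.Adj v w → top v = top w := by
    intro v w hv hw hvw
    rcases (F.adj_of_dep_one hv).1 hvw with h | h
    · rw [h, F.dep_P (F.idx_le v)] at hw
      exact absurd rfl hw
    · rw [h1 v hv, h3 v w hv (mem_leaves.2 ⟨h.1, h.2.1⟩)]
  refine ⟨top, h1, h2, h3, fun v w hv hw hvw => ?_⟩
  have hv2 := F.dep_le v
  have hw2 := F.dep_le w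
  obtain hv1 | hv1 : dep v = 1 ∨ dep v = 2 := by omega
  · exact h4 v w hv1 hw hvw
  · have h5 := h2 v hv1
    by_cases hwt : w = top v
    · rw [hwt, h1 _ h5.1]
    · have h6 := F.dist_of_leaf hv1 h5.1 h5.2 (w := w) (by rintro rfl; exact G.irrefl hvw)
      rw [dist_eq_one_iff_adj.2 hvw] at h6
      exact absurd (F.tree.connected.dist_eq_zero_iff.1 (by omega)).symm hwt

/-- The components of the separation are stars, one for each child `v` of the root, with center `v`;
the star of `v` consists of `v`, its leaves and the new vertex on the edge from the root to `v`. -/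
theorem smallSeparation_iff [Fintype V] (F : PathFrame G 0 P idx dep) :
    SmallSeparation G (P 0) ↔ SmallBranches (kids idx dep 0) fun v => (leaves G dep v).card := by
  obtain ⟨top, htop1, htop2, htopl, htopadj⟩ := F.exists_branch
  have hne : ∀ w, w ≠ P 0 → dep w ≠ 0 := fun w hw h => hw (F.dep_eq_zero_iff.1 h)
  have hne' : ∀ w, dep w ≠ 0 → w ≠ P 0 := fun w hw h => hw (F.dep_eq_zero_iff.2 h)
  let S := separation G (P 0)
  let T : {w : V // w ≠ P 0} ⊕ {w : V // G.Adj (P 0) w} → V :=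
    Sum.elim (fun w => top w) (fun w => w)
  have hT : ∀ x y, S.Adj x y → T x = T y := by
    rintro (x | x) (y | y) h
    · exact htopadj x y (hne _ x.2) (hne _ y.2) h
    · have h' : (x : V) = y := h
      show top x = y
      rw [h', htop1 _ (F.adj_root_iff.1 y.2)]
    · have h' : (x : V) = y := h
      show (x : V) = top y
      rw [← h', htop1 _ (F.adj_root_iff.1 x.2)]
    · exact absurd h id
  have hTr : ∀ x y, S.Reachable x y → T x = T y := by
    rintro x y ⟨p⟩
    induction p with
    | nil => rfl
    | cons h _ ih => exact (hT _ _ h).trans ih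
  have htop_adj : ∀ w, w ≠ P 0 → G.Adj (P 0) (top w) := by
    intro w hw
    rw [F.adj_root_iff]
    have h1 := hne w hw
    have h2 := F.dep_le w
    obtain h3 | h3 : dep w = 1 ∨ dep w = 2 := by omega
    · rw [htop1 w h3, h3]
    · exact (htop2 w h3).1
  have hTadj : ∀ x, G.Adj (P 0) (T x) := by
    rintro (x | x)
    · exact htop_adj x x.2
    · exact x.2
  have hreach : ∀ x, S.Reachable x (Sum.inr ⟨T x, hTadj x⟩) := by
    rintro (x | x)
    · have h1 := htop_adj x x.2
      have h2 : S.Adj (Sum.inl ⟨top x, h1.ne.symm⟩) (Sum.inr ⟨top x, h1⟩) := rfl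
      have h3 := hne x x.2
      have h4 := F.dep_le (x : V)
      obtain h5 | h5 : dep (x : V) = 1 ∨ dep (x : V) = 2 := by omega
      · have h6 : x = ⟨top x, h1.ne.symm⟩ := Subtype.ext (htop1 _ h5).symm
        have h7 := h2.reachable
        rw [← h6] at h7
        exact h7
      · have h6 : S.Adj (Sum.inl x) (Sum.inl ⟨top x, h1.ne.symm⟩) := (htop2 _ h5).2.symm
        exact h6.reachable.trans h2.reachable
    · exact Reachable.refl _
  let e : {w : V // G.Adj (P 0) w} → S.ConnectedComponent :=
    fun v => S.connectedComponentMk (Sum.inr v)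
  have he : Function.Bijective e := by
    constructor
    · intro v w hvw
      exact Subtype.ext (hTr _ _ (ConnectedComponent.exact hvw))
    · intro D
      induction D using ConnectedComponent.ind with
      | _ x => exact ⟨⟨T x, hTadj x⟩, ConnectedComponent.sound (hreach x).symm⟩
  have hmem : ∀ v x, x ∈ (e v).supp ↔ T x = v := by
    intro v x
    rw [ConnectedComponent.mem_supp_iff]
    constructor
    · intro h
      exact hTr _ _ (ConnectedComponent.exact h)
    · intro h
      have h1 : (⟨T x, hTadj x⟩ : {w : V // G.Adj (P 0) w}) = v := Subtype.ext h
      rw [← h1]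
      exact ConnectedComponent.sound (hreach x)
  have hstar : ∀ v, ∃ c, (e v).toSimpleGraph = starGraph c := by
    intro v
    have hv1 := F.adj_root_iff.1 v.2
    have hleaf : ∀ y : V, dep y ≠ 0 → y ≠ v → top y = v → G.Adj v y := by
      intro y hy hyv hty
      have h2 := F.dep_le y
      obtain h3 | h3 : dep y = 1 ∨ dep y = 2 := by omega
      · exact absurd ((htop1 y h3).symm.trans hty) hyv
      · rw [← hty]
        exact (htop2 y h3).2
    have hcenter : ∀ x y : V, dep x ≠ 0 → dep y ≠ 0 → top x = v → top y = v → G.Adj x y →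
        x = v ∨ y = v := by
      intro x y hx hy htx hty hxy
      have h2 := F.dep_le x
      obtain h3 | h3 : dep x = 1 ∨ dep x = 2 := by omega
      · exact Or.inl ((htop1 x h3).symm.trans htx)
      · right
        have h5 := htop2 x h3
        by_contra hyt
        rw [← htx] at hyt
        have h6 := F.dist_of_leaf h3 h5.1 h5.2 (w := y) (by rintro rfl; exact G.irrefl hxy)
        rw [dist_eq_one_iff_adj.2 hxy] at h6
        exact hyt (F.tree.connected.dist_eq_zero_iff.1 (by omega)).symm
    refine ⟨⟨Sum.inl ⟨v, v.2.ne.symm⟩, (hmem v _).2 (htop1 _ hv1)⟩, ?_⟩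
    ext ⟨x, hx⟩ ⟨y, hy⟩
    rw [ConnectedComponent.toSimpleGraph_adj, starGraph_adj]
    have hTx := (hmem v x).1 hx
    have hTy := (hmem v y).1 hy
    rcases x with x | x <;> rcases y with y | y
    · have hx' : top x = v := hTx
      have hy' : top y = v := hTy
      have hx0 := hne x x.2
      have hy0 := hne y y.2
      simp only [ne_eq, Subtype.mk.injEq, Sum.inl.injEq]
      show G.Adj x y ↔ _
      rw [Subtype.ext_iff, Subtype.ext_iff, Subtype.ext_iff]
      constructor
      · exact fun h => ⟨h.ne, hcenter x y hx0 hy0 hx' hy' h⟩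
      · rintro ⟨h1, h2 | h2⟩
        · have h2' : (x : V) = v := h2
          rw [h2'] at h1 ⊢
          exact hleaf y hy0 (Ne.symm h1) hy'
        · have h2' : (y : V) = v := h2
          rw [h2'] at h1 ⊢
          exact (hleaf x hx0 h1 hx').symm
    · have hy' : (y : V) = v := hTy
      simp only [ne_eq, Subtype.mk.injEq, reduceCtorEq, not_false_eq_true, or_false, true_and,
        Sum.inl.injEq]
      show (x : V) = y ↔ _
      rw [Subtype.ext_iff, hy']
    · have hx' : (x : V) = v := hTx
      simp only [ne_eq, Subtype.mk.injEq, reduceCtorEq, not_false_eq_true, false_or, true_and,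
        Sum.inl.injEq]
      show (x : V) = y ↔ _
      rw [Subtype.ext_iff, hx', eq_comm]
    · have hx' : (x : V) = v := hTx
      have hy' : (y : V) = v := hTy
      have hxy : x = y := Subtype.ext (hx'.trans hy'.symm)
      simp [hxy]
  have hcard : ∀ v, Nat.card (e v) = (leaves G dep v).card + 2 := by
    intro v
    have hv1 := F.adj_root_iff.1 v.2
    let A : Set {w : V // w ≠ P 0} := {w | top w = v}
    have h1 : (e v).supp = Sum.inl '' A ∪ {Sum.inr v} := by
      ext x
      rw [hmem]
      rcases x with x | x
      · simp [A, T]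
      · simp [T, Subtype.ext_iff]
    have h2 : Subtype.val '' A = ↑(insert (v : V) (leaves G dep v)) := by
      ext w
      rw [Finset.mem_coe, Finset.mem_insert]
      constructor
      · rintro ⟨x, hx, rfl⟩
        have hx' : top x = v := hx
        have h3 := hne x x.2
        have h4 := F.dep_le (x : V)
        obtain h5 | h5 : dep (x : V) = 1 ∨ dep (x : V) = 2 := by omega
        · exact Or.inl ((htop1 _ h5).symm.trans hx')
        · right
          rw [← hx', mem_leaves]
          exact ⟨(htop2 _ h5).2, h5⟩
      · rintro (rfl | hw)
        · exact ⟨⟨v, v.2.ne.symm⟩, htop1 _ hv1, rfl⟩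
        · exact ⟨⟨w, hne' w (by rw [(mem_leaves.1 hw).2]; omega)⟩, htopl _ _ hv1 hw, rfl⟩
    have h3 : A.ncard = (leaves G dep v).card + 1 := by
      rw [← Set.ncard_image_of_injective A Subtype.val_injective, h2, Set.ncard_coe_finset,
        Finset.card_insert_of_notMem]
      rw [mem_leaves]
      exact fun h => G.irrefl h.1
    show Nat.card (e v).supp = _
    rw [Nat.card_coe_set_eq, h1, Set.ncard_union_eq (by simp) (Set.toFinite _) (Set.toFinite _),
      Set.ncard_image_of_injective _ Sum.inl_injective, h3, Set.ncard_singleton]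
  have hp2 : ∀ v, IsPathOn 2 (e v).toSimpleGraph ↔ (leaves G dep v).card = 0 := by
    intro v
    obtain ⟨c, hc⟩ := hstar v
    rw [hc, isPathOn_two_starGraph_iff, hcard]
    omega
  have hp3 : ∀ v, IsPathOn 3 (e v).toSimpleGraph ↔ (leaves G dep v).card = 1 := by
    intro v
    obtain ⟨c, hc⟩ := hstar v
    rw [hc, isPathOn_three_starGraph_iff, hcard]
    omega
  have hs4 : ∀ v, IsS4 (e v).toSimpleGraph ↔ (leaves G dep v).card = 2 := by
    intro v
    obtain ⟨c, hc⟩ := hstar v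
    rw [hc, isS4_starGraph_iff, hcard]
    omega
  have hkid : ∀ w, w ∈ kids idx dep 0 ↔ G.Adj (P 0) w := by
    intro w
    rw [mem_kids, F.adj_root_iff, and_iff_right (Nat.le_zero.1 (F.idx_le w))]
  have hset : ∀ (Q : S.ConnectedComponent → Prop) (j : ℕ),
      (∀ v, Q (e v) ↔ (leaves G dep v).card = j) →
      {D | Q D}.ncard = ((kids idx dep 0).filter fun v => (leaves G dep v).card = j).card := by
    intro Q j hQ
    have h1 : {D | Q D} = e '' {v | (leaves G dep v).card = j} := by
      ext D
      obtain ⟨v, rfl⟩ := he.2 D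
      rw [Set.mem_ofPred_eq, hQ, he.1.mem_set_image]
      rfl
    have h2 : ((kids idx dep 0).filter fun v => (leaves G dep v).card = j : Set V) =
        Subtype.val '' {v : {w : V // G.Adj (P 0) w} | (leaves G dep v).card = j} := by
      ext w
      simp only [Finset.coe_filter, Set.mem_ofPred_eq, hkid, Set.mem_image, Subtype.exists,
        exists_and_left, exists_prop, exists_eq_right_right]
      tauto
    rw [h1, Set.ncard_image_of_injective _ he.1, ← Set.ncard_coe_finset, h2,
      Set.ncard_image_of_injective _ Subtype.val_injective]
  have hall : Nat.card S.ConnectedComponent = (kids idx dep 0).card := by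
    rw [← Nat.card_congr (Equiv.ofBijective e he),
      ← Nat.card_congr (Equiv.subtypeEquivRight hkid), Nat.card_eq_fintype_card, Fintype.card_coe]
  rw [SmallSeparation, SmallBranches, hset _ 0 hp2, hset _ 2 hs4, hall]
  refine and_congr_right fun _ => and_congr_left fun _ => ?_
  rw [he.2.forall]
  constructor
  · intro h v hv
    have h1 := h ⟨v, (hkid v).1 hv⟩
    rw [hp2, hp3, hs4] at h1
    show (leaves G dep v).card ≤ 2
    simp only at h1
    omega
  · intro h v
    have h1 : (leaves G dep v).card ≤ 2 := h v ((hkid v).2 v.2)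
    rw [hp2, hp3, hs4]
    omega

end PathFrame

/-! ### The components of `G - E(P)` -/

/-- The condition `SmallBranches` on the branches at `r` in terms of degrees: a branch with `k`
leaves hangs at a neighbour of `r` of degree `k + 1`. -/
def SmallDegrees (H : SimpleGraph V) (r : V) : Prop :=
  (H.neighborSet r).ncard ≤ 4 ∧ (∀ v ∈ H.neighborSet r, (H.neighborSet v).ncard ≤ 3) ∧
    {v | v ∈ H.neighborSet r ∧ (H.neighborSet v).ncard = 1}.ncard ≤ 2 ∧
    {v | v ∈ H.neighborSet r ∧ (H.neighborSet v).ncard = 3}.ncard ≤ 2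

lemma image_neighborSet_toSimpleGraph {H : SimpleGraph V} (C : H.ConnectedComponent) (x : C) :
    Subtype.val '' C.toSimpleGraph.neighborSet x = H.neighborSet x := by
  ext w
  constructor
  · rintro ⟨y, hy, rfl⟩
    exact hy
  · intro hw
    exact ⟨⟨w, C.mem_supp_of_adj_mem_supp x.2 hw⟩, hw, rfl⟩

lemma smallDegrees_toSimpleGraph_iff {H : SimpleGraph V} (C : H.ConnectedComponent) (r : C) :
    SmallDegrees C.toSimpleGraph r ↔ SmallDegrees H r := by
  have h1 : ∀ x : C, (C.toSimpleGraph.neighborSet x).ncard = (H.neighborSet x).ncard := by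
    intro x
    rw [← image_neighborSet_toSimpleGraph, Set.ncard_image_of_injective _ Subtype.val_injective]
  have h2 : ∀ k, {v | v ∈ C.toSimpleGraph.neighborSet r ∧
      (C.toSimpleGraph.neighborSet v).ncard = k}.ncard =
      {v | v ∈ H.neighborSet r ∧ (H.neighborSet v).ncard = k}.ncard := by
    intro k
    rw [← Set.ncard_image_of_injective _ Subtype.val_injective, ← image_neighborSet_toSimpleGraph]
    congr 1
    ext w
    constructor
    · rintro ⟨y, ⟨hy, hy'⟩, rfl⟩
      exact ⟨⟨y, hy, rfl⟩, (h1 y).symm.trans hy'⟩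
    · rintro ⟨⟨y, hy, rfl⟩, hy'⟩
      exact ⟨y, ⟨hy, (h1 y).trans hy'⟩, rfl⟩
  rw [SmallDegrees, SmallDegrees, h1, h2, h2]
  refine and_congr_right fun _ => and_congr_left fun _ => ?_
  rw [← image_neighborSet_toSimpleGraph, Set.forall_mem_image]
  simp only [h1]

namespace PathFrame

variable {a b : V} {p : G.Walk a b} {idx dep : V → ℕ}

lemma not_mem_edges (F : PathFrame G p.length p.getVert idx dep) {v w : V} (h : dep v ≠ 0) :
    s(v, w) ∉ p.edges := by
  intro he
  obtain ⟨i, rfl, hi⟩ := Walk.mem_support_iff_exists_getVert.1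
    (Walk.fst_mem_support_of_mem_edges _ he)
  exact h (F.dep_P hi)

lemma deletePath_adj_iff (F : PathFrame G p.length p.getVert idx dep) {v w : V} (h : dep v ≠ 0) :
    (deletePath G p).Adj v w ↔ G.Adj v w := by
  rw [deletePath, deleteEdges_adj, and_iff_left]
  exact F.not_mem_edges h

lemma mem_edges_of_dep_zero (F : PathFrame G p.length p.getVert idx dep) {v w : V}
    (hv : dep v = 0) (hw : dep w = 0) (h : G.Adj v w) : s(v, w) ∈ p.edges := by
  have h1 := F.dist_P _ (F.idx_le v) w
  have h2 := F.idx_le v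
  have h3 := F.idx_le w
  rw [← F.eq_P hv, dist_eq_one_iff_adj.2 h] at h1
  rw [Walk.mk_mem_edges_iff_exists]
  obtain h4 | h4 : idx w = idx v + 1 ∨ idx v = idx w + 1 := by omega
  · refine ⟨idx v, by omega, ?_⟩
    rw [← h4, ← F.eq_P hv, ← F.eq_P hw]
  · refine ⟨idx w, by omega, ?_⟩
    rw [← h4, ← F.eq_P hv, ← F.eq_P hw, Sym2.eq_swap]

lemma deletePath_neighborSet_root [Fintype V] (F : PathFrame G p.length p.getVert idx dep) {i : ℕ}
    (hi : i ≤ p.length) :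
    (deletePath G p).neighborSet (p.getVert i) = ↑(kids idx dep i) := by
  ext w
  rw [mem_neighborSet, Finset.mem_coe, mem_kids]
  constructor
  · intro h
    have hd : dep w ≠ 0 := by
      intro h0
      rw [deletePath, deleteEdges_adj] at h
      exact h.2 (F.mem_edges_of_dep_zero (F.dep_P hi) h0 h.1)
    rw [deletePath, deleteEdges_adj, ← dist_eq_one_iff_adj, F.dist_P i hi] at h
    omega
  · rintro ⟨rfl, hw⟩
    rw [adj_comm, F.deletePath_adj_iff (by omega)]
    exact (F.adj_root hw).symm

lemma deletePath_neighborSet_kid [Fintype V] (F : PathFrame G p.length p.getVert idx dep) {v : V}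
    (hv : dep v = 1) :
    (deletePath G p).neighborSet v = ↑(insert (p.getVert (idx v)) (leaves G dep v)) := by
  ext w
  rw [mem_neighborSet, F.deletePath_adj_iff (by omega), F.adj_of_dep_one hv, Finset.mem_coe,
    Finset.mem_insert, mem_leaves]
  refine or_congr_right ⟨fun h => ⟨h.1, h.2.1⟩, fun h => ⟨h.1, h.2, ?_⟩⟩
  exact F.idx_of_mem_leaves hv (mem_leaves.2 h)

lemma smallDegrees_iff [Fintype V] (F : PathFrame G p.length p.getVert idx dep) {i : ℕ}
    (hi : i ≤ p.length) : SmallDegrees (deletePath G p) (p.getVert i) ↔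
      SmallBranches (kids idx dep i) fun v => (leaves G dep v).card := by
  have h1 : ∀ v ∈ kids idx dep i,
      ((deletePath G p).neighborSet v).ncard = (leaves G dep v).card + 1 := by
    intro v hv
    rw [mem_kids] at hv
    rw [F.deletePath_neighborSet_kid hv.2, Set.ncard_coe_finset, Finset.card_insert_of_notMem]
    rw [mem_leaves, F.dep_P (F.idx_le v)]
    omega
  have h2 : ∀ k, {v | v ∈ (deletePath G p).neighborSet (p.getVert i) ∧
      ((deletePath G p).neighborSet v).ncard = k + 1}.ncard =
      ((kids idx dep i).filter fun v => (leaves G dep v).card = k).card := by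
    intro k
    rw [← Set.ncard_coe_finset]
    congr 1
    ext v
    rw [Set.mem_ofPred_eq, F.deletePath_neighborSet_root hi, Finset.mem_coe, Finset.mem_coe,
      Finset.mem_filter]
    refine and_congr_right fun hv => ?_
    rw [h1 v hv]
    omega
  rw [SmallDegrees, SmallBranches, h2 0, h2 2, F.deletePath_neighborSet_root hi,
    Set.ncard_coe_finset]
  refine and_congr_right fun _ => and_congr_left fun _ => forall₂_congr fun v hv => ?_
  rw [h1 v hv]
  exact Nat.succ_le_succ_iff

lemma idx_eq_of_deletePath_adj (F : PathFrame G p.length p.getVert idx dep) {v w : V}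
    (h : (deletePath G p).Adj v w) : idx v = idx w := by
  have hG : G.Adj v w := (deleteEdges_adj.1 h).1
  have key : ∀ v w, G.Adj v w → dep v = 1 → idx v = idx w := by
    intro v w hvw hv
    rcases (F.adj_of_dep_one hv).1 hvw with h1 | h1
    · rw [h1, F.idx_P _ (F.idx_le v)]
    · exact h1.2.2.symm
  have key2 : ∀ v w, G.Adj v w → dep v = 2 → idx v = idx w := by
    intro v w hvw hv
    obtain ⟨x, hx, hx1, hxi⟩ := F.exists_parent hv
    have h1 := F.dist_of_leaf hv hx1 hx (w := w) hvw.ne.symm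
    rw [dist_eq_one_iff_adj.2 hvw] at h1
    rw [← hxi, F.tree.connected.dist_eq_zero_iff.1 (by omega : G.dist x w = 0)]
  have hv := F.dep_le v
  have hw := F.dep_le w
  by_cases h1 : dep v = 1
  · exact key v w hG h1
  by_cases h2 : dep v = 2
  · exact key2 v w hG h2
  by_cases h3 : dep w = 1
  · exact (key w v hG.symm h3).symm
  by_cases h4 : dep w = 2
  · exact (key2 w v hG.symm h4).symm
  exact absurd (F.mem_edges_of_dep_zero (by omega) (by omega) hG) (deleteEdges_adj.1 h).2

lemma idx_eq_of_mem (F : PathFrame G p.length p.getVert idx dep)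
    {C : (deletePath G p).ConnectedComponent} (x y : C) : idx x = idx y := by
  obtain ⟨q⟩ := C.reachable_of_mem_supp x.2 y.2
  have : ∀ v w, (deletePath G p).Walk v w → idx v = idx w := by
    intro v w q
    induction q with
    | nil => rfl
    | cons h _ ih => exact (F.idx_eq_of_deletePath_adj h).trans ih
  exact this _ _ q

/-- A component of `G - E(P)` is a tree of height at most two from its vertex on `P`. -/
theorem isCenterPath_toSimpleGraph (F : PathFrame G p.length p.getVert idx dep)
    (C : (deletePath G p).ConnectedComponent) (r : C) (hr : (r : V) ∈ p.support) :
    C.toSimpleGraph.IsTree ∧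
      IsCenterPath C.toSimpleGraph 2 (Walk.nil : C.toSimpleGraph.Walk r r) := by
  have hT : C.toSimpleGraph.IsTree :=
    (F.tree.isAcyclic.anti (deleteEdges_le _)).isTree_connectedComponent C
  refine ⟨hT, Walk.IsPath.nil, fun u => ⟨r, by simp, ?_⟩⟩
  obtain ⟨i, hir, hi⟩ := Walk.mem_support_iff_exists_getVert.1 hr
  have hri : p.getVert (idx (r : V)) = r := by rw [← hir, F.idx_P i hi]
  have kid : ∀ v : C, dep (v : V) = 1 → C.toSimpleGraph.dist v r ≤ 1 := by
    intro v hv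
    have h1 := F.adj_root hv
    rw [F.idx_eq_of_mem v r, hri] at h1
    have h2 : C.toSimpleGraph.Adj v r :=
      (F.deletePath_adj_iff (w := (r : V)) (by omega : dep (v : V) ≠ 0)).2 h1.symm
    exact (dist_eq_one_iff_adj.2 h2).le
  have hu := F.dep_le u
  obtain h0 | h0 | h0 : dep (u : V) = 0 ∨ dep (u : V) = 1 ∨ dep (u : V) = 2 := by omega
  · have h1 := F.eq_P h0
    rw [F.idx_eq_of_mem u r, hri] at h1
    rw [Subtype.ext h1, SimpleGraph.dist_self]
    omega
  · exact (kid u h0).trans (by omega)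
  · obtain ⟨v, hv, hv1, -⟩ := F.exists_parent h0
    have h1 : (deletePath G p).Adj u v := (F.deletePath_adj_iff (by omega)).2 hv.symm
    let v' : C := ⟨v, C.mem_supp_of_adj_mem_supp u.2 h1⟩
    have h2 : C.toSimpleGraph.dist u v' = 1 := dist_eq_one_iff_adj.2 h1
    have h3 := hT.connected.dist_triangle (u := u) (v := v') (w := r)
    have h4 := kid v' hv1
    omega

end PathFrame

/-! ### Trees of height two -/

section Height

variable [Fintype V] {P : ℕ → V} {idx dep : V → ℕ}

/-- A tree of height two with a single branch, which has two leaves, is an `S_4` rooted at a leaf.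
-/
lemma PathFrame.isLeafRootedS4 (F : PathFrame G 0 P idx dep) {v : V} (hK : kids idx dep 0 = {v})
    (hv2 : (leaves G dep v).card = 2) : IsLeafRootedS4 G (P 0) := by
  have hidx : ∀ v, idx v = 0 := fun v => Nat.le_zero.1 (F.idx_le v)
  have hkid : ∀ w, dep w = 1 ↔ w = v := by
    intro w
    rw [← Finset.mem_singleton (a := v), ← hK, mem_kids, and_iff_right (hidx w)]
  have hv1 : dep v = 1 := (hkid v).2 rfl
  have hleaf : ∀ w, dep w = 2 → G.Adj v w := by
    intro w hw
    obtain ⟨x, hx, hx1, -⟩ := F.exists_parent hw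
    rwa [← (hkid x).1 hx1]
  have hstar : G = starGraph v := by
    have hcenter : ∀ x, x ≠ v → G.Adj v x := by
      intro x hx
      have h1 := F.dep_le x
      have h2 := (hkid x).not.2 hx
      obtain h3 | h3 : dep x = 0 ∨ dep x = 2 := by omega
      · rw [F.dep_eq_zero_iff.1 h3]
        exact (F.adj_root_iff.2 hv1).symm
      · exact hleaf x h3
    ext x y
    rw [starGraph_adj]
    constructor
    · intro h
      refine ⟨h.ne, ?_⟩
      by_contra hxy
      rw [not_or] at hxy
      have h1 := IsTree.dist_adj F.tree h v
      rw [dist_eq_one_iff_adj.2 (hcenter x hxy.1).symm,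
        dist_eq_one_iff_adj.2 (hcenter y hxy.2).symm] at h1
      omega
    · rintro ⟨h1, rfl | rfl⟩
      · exact hcenter y h1.symm
      · exact (hcenter x h1).symm
  have hcard : Nat.card V = 4 := by
    have h1 : (Finset.univ : Finset V) = insert (P 0) (insert v (leaves G dep v)) := by
      ext w
      simp only [Finset.mem_univ, Finset.mem_insert, mem_leaves, true_iff]
      have h1 := F.dep_le w
      obtain h2 | h2 | h2 : dep w = 0 ∨ dep w = 1 ∨ dep w = 2 := by omega
      · exact Or.inl (F.dep_eq_zero_iff.1 h2)
      · exact Or.inr (Or.inl ((hkid w).1 h2))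
      · exact Or.inr (Or.inr ⟨hleaf w h2, h2⟩)
    rw [Nat.card_eq_fintype_card, ← Finset.card_univ, h1, Finset.card_insert_of_notMem,
      Finset.card_insert_of_notMem, hv2]
    · rw [mem_leaves]
      omega
    · rw [Finset.mem_insert, mem_leaves, F.dep_P le_rfl]
      rintro (h | h)
      · rw [← h, F.dep_P le_rfl] at hv1
        omega
      · omega
  refine ⟨?_, ?_⟩
  · rw [hstar]
    exact (isS4_starGraph_iff v).2 hcard
  · have h1 : G.neighborSet (P 0) = {v} := by
      ext w
      rw [mem_neighborSet, F.adj_root_iff, hkid, Set.mem_singleton_iff]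
    rw [IsLeaf, h1, Set.ncard_singleton]

end Height

lemma IsLeafRootedS4.smallDegrees [Finite V] {r : V} (h : IsLeafRootedS4 G r) :
    SmallDegrees G r := by
  obtain ⟨⟨e⟩, h1⟩ := h
  rw [IsLeaf] at h1
  have hcard : Nat.card V = 4 := by simpa using Nat.card_congr e.toEquiv
  have hsub : ∀ Q : V → Prop, {v | v ∈ G.neighborSet r ∧ Q v}.ncard ≤ 2 := by
    intro Q
    have h2 : {v | v ∈ G.neighborSet r ∧ Q v}.ncard ≤ (G.neighborSet r).ncard :=
      Set.ncard_le_ncard fun v hv => hv.1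
    omega
  refine ⟨by omega, fun v _ => ?_, hsub _, hsub _⟩
  have h2 : G.neighborSet v ⊆ {v}ᶜ := by
    rintro w hw rfl
    exact G.irrefl hw
  have h3 := Set.ncard_le_ncard h2
  rw [Set.ncard_compl, Set.ncard_singleton, hcard] at h3
  exact h3

lemma deletePath_nil (r : V) : deletePath G (Walk.nil : G.Walk r r) = G := by
  simp [deletePath]

/-- For a tree of height at most two, having a small separation and having finite multiset dimension
unless it is an `S_4` rooted at a leaf amount to the same condition on degrees. -/
theorem smallSeparation_and_infinite_iff [Finite V] {r : V} (hG : G.IsTree)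
    (hr : IsCenterPath G 2 (Walk.nil : G.Walk r r)) :
    (SmallSeparation G r ↔ SmallDegrees G r) ∧
    ((multisetDim G = ⊤ → IsLeafRootedS4 G r) ↔ SmallDegrees G r) := by
  cases nonempty_fintype V
  obtain ⟨idx, dep, F⟩ := exists_pathFrame hG _ hr
  have h1 := F.smallDegrees_iff (i := 0) le_rfl
  rw [deletePath_nil, Walk.getVert_zero] at h1
  have h2 := F.smallSeparation_iff
  rw [Walk.getVert_zero] at h2
  have h3 : multisetDim G ≠ ⊤ → SmallDegrees G r := by
    rw [multisetDim_ne_top_iff]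
    rintro ⟨W, hW⟩
    exact h1.2 (F.smallBranches_of_isMResolving hW 0)
  refine ⟨h2.trans h1.symm, ?_, ?_⟩
  · intro h
    by_cases ht : multisetDim G = ⊤
    · exact (h ht).smallDegrees
    · exact h3 ht
  · intro h ht
    by_contra hS
    refine absurd ht (multisetDim_ne_top_iff.2 (F.exists_isMResolving_of_zero (h1.1 h) ?_))
    rintro ⟨v, hv, hv2⟩
    have := F.isLeafRootedS4 hv hv2
    rw [Walk.getVert_zero] at this
    exact hS this

/-! ### Minimal paths and the equivalence -/

/-- Dropping an end of a minimum `2`-center-path leaves some vertex uncovered, and such a vertex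
lies at depth two below this end. -/
lemma exists_depth_two_of_isMinCenterPath {a b : V} {p : G.Walk a b} {idx dep : V → ℕ}
    (F : PathFrame G p.length p.getVert idx dep) (hp : IsMinCenterPath G 2 p) (hℓ : 0 < p.length) :
    (∃ w, idx w = 0 ∧ dep w = 2) ∧ ∃ w, idx w = p.length ∧ dep w = 2 := by
  have hd : ∀ w i, i ≤ p.length → G.dist w (p.getVert i) =
      (i - idx w) + (idx w - i) + dep w := by
    intro w i hi
    rw [G.dist_comm, F.dist_P i hi]
  have key : ∀ (c d : V) (q : G.Walk c d) (i j : ℕ), i ≤ p.length → j ≤ p.length →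
      (i + 1 = j ∨ j + 1 = i) → q.IsPath → q.length < p.length →
      (∀ m ≤ p.length, m ≠ i → p.getVert m ∈ q.support) → ∃ w, idx w = i ∧ dep w = 2 := by
    intro c d q i j hi hj hij hq hlt hsupp
    by_contra! hno
    refine absurd (hp.2 c d q ⟨hq, fun u => ?_⟩) (by omega)
    have h1 := F.dep_le u
    have h2 := F.idx_le u
    by_cases hu : idx u = i
    · have h3 := hno u hu
      exact ⟨_, hsupp j hj (by omega), by rw [hd u j hj]; omega⟩
    · exact ⟨_, hsupp _ h2 hu, by rw [hd u _ h2]; omega⟩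
  have hnil : ¬ p.Nil := by
    rw [Walk.not_nil_iff_lt_length]
    exact hℓ
  constructor
  · refine key _ _ p.tail 0 1 (by omega) (by omega) (by omega) hp.1.1.tail ?_ ?_
    · have := Walk.length_tail_add_one hnil
      omega
    · intro m hm hm0
      rw [Walk.mem_support_iff_exists_getVert]
      have := Walk.length_tail_add_one hnil
      refine ⟨m - 1, ?_, by omega⟩
      rw [Walk.getVert_tail]
      congr 1
      omega
  · refine key _ _ (p.take (p.length - 1)) p.length (p.length - 1) le_rfl (by omega) (by omega)
      (hp.1.1.take _) ?_ ?_
    · rw [Walk.take_length]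
      omega
    · intro m hm hm0
      rw [Walk.mem_support_iff_exists_getVert]
      refine ⟨m, ?_, by rw [Walk.take_length]; omega⟩
      rw [Walk.take_getVert]
      congr 1
      omega

/-- A path vertex with a single neighbour `P j` on the path, that is an end of a path of positive
length, has one more neighbour than it has children. -/
lemma ncard_neighborSet_eq [Fintype V] {a b : V} {p : G.Walk a b} {idx dep : V → ℕ}
    (F : PathFrame G p.length p.getVert idx dep) {i j : ℕ} (hi : i ≤ p.length) (hj : j ≤ p.length)
    (hij : ∀ m ≤ p.length, (m + 1 = i ∨ i + 1 = m) ↔ m = j) :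
    (G.neighborSet (p.getVert i)).ncard = (kids idx dep i).card + 1 := by
  have h : G.neighborSet (p.getVert i) = ↑(insert (p.getVert j) (kids idx dep i)) := by
    ext w
    have hw := F.idx_le w
    have hm := hij (idx w) hw
    rw [mem_neighborSet, ← dist_eq_one_iff_adj, F.dist_P i hi, Finset.mem_coe, Finset.mem_insert,
      mem_kids]
    constructor
    · intro h
      by_cases h0 : dep w = 0
      · left
        rw [← hm.1 (by omega)]
        exact F.eq_P h0
      · right
        omega
    · rintro (rfl | h)
      · rw [F.idx_P j hj, F.dep_P hj]
        have := (hij j hj).2 rfl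
        omega
      · omega
  rw [h, Set.ncard_coe_finset, Finset.card_insert_of_notMem]
  rw [mem_kids, F.dep_P hj]
  omega

/-- For a path of length zero the exceptional situation is that of a single branch with two leaves;
for one of length two it is that both ends have four branches. -/
theorem multisetDim_ne_top_of_smallDegrees [Finite V] {a b : V} {p : G.Walk a b} (hG : G.IsTree)
    (hp : IsMinCenterPath G 2 p) (hex : ¬ IsExceptional G p)
    (h : ∀ r ∈ p.support, SmallDegrees (deletePath G p) r) : multisetDim G ≠ ⊤ := by
  cases nonempty_fintype V
  obtain ⟨idx, dep, F⟩ := exists_pathFrame hG p hp.1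
  have hb : ∀ i ≤ p.length, SmallBranches (kids idx dep i) fun v => (leaves G dep v).card :=
    fun i hi => (F.smallDegrees_iff hi).1 (h _ (p.getVert_mem_support i))
  rw [multisetDim_ne_top_iff]
  rw [IsExceptional, not_or] at hex
  rcases Nat.eq_zero_or_pos p.length with h0 | hpos
  · rw [h0] at F
    refine F.exists_isMResolving_of_zero (hb 0 (by omega)) ?_
    rintro ⟨v, hv, hv2⟩
    have := F.isLeafRootedS4 hv hv2
    rw [Walk.getVert_zero] at this
    exact hex.1 this
  obtain ⟨e0, e1⟩ := exists_depth_two_of_isMinCenterPath F hp hpos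
  rcases Nat.mod_two_eq_zero_or_one p.length with h2 | h2
  · refine F.exists_isMResolving_of_even hpos h2 hb e0 e1 ?_
    rintro ⟨h3, h4, h5⟩
    have e2 := ncard_neighborSet_eq F (i := 0) (j := 1) (by omega) (by omega) (by omega)
    have e3 := ncard_neighborSet_eq F (i := p.length) (j := p.length - 1) le_rfl (by omega)
      (by omega)
    rw [Walk.getVert_zero, h4] at e2
    rw [Walk.getVert_length, h5] at e3
    exact hex.2 ⟨h3, e2, e3⟩
  · exact F.exists_isMResolving_of_odd h2 hb e0 e1

end MultisetDim

theorem theorem3p1 {V : Type*} [Finite V] (G : SimpleGraph V) (hG : MultisetDim.IsLobster G)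
    {a b : V} (p : G.Walk a b) (hp : MultisetDim.IsMinCenterPath G 2 p) :
    (MultisetDim.multisetDim G ≠ ⊤ → MultisetDim.OnlyS4Infinite G p) ∧
    (MultisetDim.OnlyS4Infinite G p ↔ MultisetDim.AllSeparationsSmall G p) ∧
    (¬ MultisetDim.IsExceptional G p →
      List.TFAE [MultisetDim.multisetDim G ≠ ⊤, MultisetDim.OnlyS4Infinite G p,
        MultisetDim.AllSeparationsSmall G p]) := by
  open MultisetDim in
  obtain ⟨idx, dep, F⟩ := exists_pathFrame hG.1 p hp.1
  have hC : ∀ (C : (deletePath G p).ConnectedComponent) (r : C), (r : V) ∈ p.support →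
      (SmallSeparation C.toSimpleGraph r ↔ SmallDegrees (deletePath G p) r) ∧
      ((multisetDim C.toSimpleGraph = ⊤ → IsLeafRootedS4 C.toSimpleGraph r) ↔
        SmallDegrees (deletePath G p) r) := by
    intro C r hr
    obtain ⟨hT, hc⟩ := F.isCenterPath_toSimpleGraph C r hr
    obtain ⟨h1, h2⟩ := smallSeparation_and_infinite_iff hT hc
    rw [smallDegrees_toSimpleGraph_iff] at h1 h2
    exact ⟨h1, h2⟩
  have h23 : OnlyS4Infinite G p ↔ AllSeparationsSmall G p :=
    forall₃_congr fun C r hr => (hC C r hr).2.trans (hC C r hr).1.symm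
  have h12 : multisetDim G ≠ ⊤ → OnlyS4Infinite G p := by
    intro h C r hr
    refine (hC C r hr).2.2 ?_
    cases nonempty_fintype V
    obtain ⟨W, hW⟩ := multisetDim_ne_top_iff.1 h
    obtain ⟨i, hir, hi⟩ := SimpleGraph.Walk.mem_support_iff_exists_getVert.1 hr
    rw [← hir]
    exact (F.smallDegrees_iff hi).2 (F.smallBranches_of_isMResolving hW i)
  refine ⟨h12, h23, fun hex => ?_⟩
  have h31 : AllSeparationsSmall G p → multisetDim G ≠ ⊤ := by
    intro h
    refine multisetDim_ne_top_of_smallDegrees hG.1 hp hex fun r hr => ?_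
    let C := (deletePath G p).connectedComponentMk r
    exact (hC C ⟨r, rfl⟩ hr).1.1 (h C ⟨r, rfl⟩ hr)
  tfae_have 1 → 2 := h12
  tfae_have 2 → 3 := h23.1
  tfae_have 3 → 1 := h31
  tfae_finish
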